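/- Let $E$ be a Polish space with its Borel $\sigma$-field. **Number of particles.** Let $Q=(q_{ij})_{i,j\ge 0}$ be a totally stable, conservative $Q$-matrix (in particular any regular one): $q_{ij}\ge 0$ for $i\ne j$ and $-q_{ii}=\sum_{j\ne i}q_{ij}<\infty$. Let $\varrho=(\varrho_i)_{i\ge 0}$ be a probability measure on $\mathbb Z_+$ with $\varrho_i>0$ and $\varrho_iq_{ij}=\varrho_jq_{ji}$ for all $i,j$. Put $$\mathscr E_Q(\mathbf r,\mathbf r)=\sum_{n\ge 0}\sum_{m>n}\varrho_nq_{nm}(r_n-r_m)^2,\qquad \mathscr D(\mathscr E_Q)=\{\mathbf r\in L^2(\varrho):\mathscr E_Q(\mathbf r,\mathbf r)<\infty\}.$$ **Configurations.** Let $\Gamma_0=\{\sum_{i=1}^n\delta_{x_i}: n\ge 0,\ x_i\in E\}$ with the Borel $\sigma$-field of the topology of weak convergence, and $\varphi_n(x)=\sum_{i=1}^n\delta_{x_i}$ for $x\in E^n$. Let $\mu^{(1)}$ be a probability measure on $E$, $\mu^{(n)}=(\mu^{(1)})^{n}$ the product measure on $E^n$ (with $E^0$ a point), $\mu=(\mu^{(1)})^{\mathbb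 N}$, and $\pi_{\mu,\varrho}=\sum_{n\ge 0}\varrho_n\,\mu^{(n)}\circ\varphi_n^{-1}$ on $\Gamma_0$. For $m>n\ge 0$ let $\mu^{(m)}_n(y;\cdot)$, $y\in E^n$, be a probability kernel from $E^n$ to $E^{m-n}$, symmetric in $y_1,\dots,y_n$, with $\mu^{(m)}(dy\,dx)=\mu^{(n)}(dy)\,\mu^{(m)}_n(y;dx)$ and $\mu^{(m)}_n(y;\cdot)\ll\mu^{(m-n)}$ for every $y$. **Reaction form.** For $F\in L^2(\Gamma_0,\pi_{\mu,\varrho})$ put $$\mathscr E_R^{\Gamma_0}(F,F)=\sum_{n\ge 0}\sum_{m>n}\varrho_nq_{nm}\int_{E^n}\mu^{(n)}(dy)\int_{E^{m-n}}\big(F(\varphi_n(y)+\varphi_{m-n}(x))-F(\varphi_n(y))\big)^2\,\mu_n^{(m)}(y;dx),$$ with domain $\mathscr D(\mathscr E_R^{\Gamma_0})=\{F\in L^2(\pi_{\mu,\varrho}):\mathscr E_R^{\Gamma_0}(F,F)<\infty\}$. **Diffusion form.** Let $(\mathscr E_0^{(1)},\mathscr D(\mathscr E_0^{(1)}))$ be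 a conservative symmetric Dirichlet form on $L^2(E;\mu^{(1)})$. On $L^2(E^{\mathbb N};\mu)$ put $$\mathscr E_0(f,f)=\sum_{i\ge 1}\int\mathscr E_0^{(1)}(f_{x|i},f_{x|i})\,\mu(dx),\qquad f_{x|i}(y)=f(x_1,\dots,x_{i-1},y,x_{i+1},\dots),$$ with domain all $f\in L^2(\mu)$ such that $f_{x|i}\in\mathscr D(\mathscr E_0^{(1)})$ for $\mu$-a.e. $x$ and all $i$, and $\mathscr E_0(f,f)<\infty$. Let $\mathscr E_0^{(n)}$ be its restriction to functions in $L^2(E^n;\mu^{(n)})$, regarded as functions of the first $n$ coordinates. With $F^{(n)}=F\circ\varphi_n$, put $$\mathscr E_0^{\Gamma_0}(F,F)=\sum_{n\ge 1}\varrho_n\,\mathscr E_0^{(n)}(F^{(n)},F^{(n)}),$$ with domain $\mathscr D(\mathscr E_0^{\Gamma_0})$ all $F\in L^2(\pi_{\mu,\varrho})$ with $F^{(n)}\in\mathscr D(\mathscr E_0^{(n)})$ for all $n\ge 1$ and $\mathscr E_0^{\Gamma_0}(F,F)<\infty$. Let $\mathscr E^{\Gamma_0}=\mathscr E_0^{\Gamma_0}+\mathscr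 E_R^{\Gamma_0}$ with domain $\mathscr D(\mathscr E^{\Gamma_0})=\mathscr D(\mathscr E_0^{\Gamma_0})\cap\mathscr D(\mathscr E_R^{\Gamma_0})$. **Statement.** Assume $$\mathrm{gap}(\mathscr E_0)=\inf\{\mathscr E_0(f,f): f\in\mathscr D(\mathscr E_0),\ \mu(f)=0,\ \mu(f^2)=1\}>0$$ (with $\inf\emptyset=\infty$). Then there is $\beta:(0,\infty)\to(0,\infty)$ with $$\pi_{\mu,\varrho}(F^2)\le r\,\mathscr E^{\Gamma_0}(F,F)+\beta(r)\,\pi_{\mu,\varrho}(|F|)^2,\qquad r>0,\ F\in\mathscr D(\mathscr E^{\Gamma_0}),$$ if and only if there are $\beta_0,\beta_Q:(0,\infty)\to(0,\infty)$ with $$\mu^{(1)}(f^2)\le r\,\mathscr E_0^{(1)}(f,f)+\beta_0(r)\,\mu^{(1)}(|f|)^2,\qquad r>0,\ f\in\mathscr D(\mathscr E_0^{(1)}),$$ $$\varrho(\mathbf r^2)\le r\,\mathscr E_Q(\mathbf r,\mathbf r)+\beta_Q(r)\,\varrho(|\mathbf r|)^2,\qquad r>0,\ \mathbf r\in\mathscr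 D(\mathscr E_Q).$$ -/

import Mathlib

open MeasureTheory ProbabilityTheory Filter Topology
open scoped ENNReal

noncomputable section

/-! ### Symmetric Dirichlet forms and functional inequalities -/

/-- A symmetric Dirichlet form on `L²(X; μ)`: a densely defined, nonnegative definite, symmetric
bilinear form which is closed and Markovian (the unit contraction operates on it). -/
structure SymmDirichletForm {X : Type*} [MeasurableSpace X] (μ : Measure X) where
  /-- the domain -/
  domain : Submodule ℝ (Lp ℝ 2 μ)
  /-- the form -/
  form : domain →ₗ[ℝ] domain →ₗ[ℝ] ℝ
  symm : ∀ f g, form f g = form g f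
  nonneg : ∀ f, 0 ≤ form f f
  dense : Dense (domain : Set (Lp ℝ 2 μ))
  /-- The domain is complete for the norm `(‖f‖² + form f f)^{1/2}`. -/
  closed : ∀ u : ℕ → domain,
    (∀ ε : ℝ, 0 < ε → ∃ N, ∀ m, N ≤ m → ∀ n, N ≤ n →
      ‖u m - u n‖ ^ 2 + form (u m - u n) (u m - u n) < ε) →
    ∃ f : domain, Tendsto (fun n => ‖u n - f‖ ^ 2 + form (u n - f) (u n - f)) atTop (𝓝 0)
  /-- If `f` is in the domain, so is `(f ∨ 0) ∧ 1`, with a smaller energy. -/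
  markov : ∀ f : domain, ∃ g : domain,
    (((g : Lp ℝ 2 μ) : X → ℝ) =ᵐ[μ] fun x => min (max (((f : Lp ℝ 2 μ) : X → ℝ) x) 0) 1) ∧
      form g g ≤ form f f

/-- A Dirichlet form on a probability space is conservative if the constant `1` belongs to the
domain and has energy zero (equivalently, the semigroup fixes `1`). -/
def SymmDirichletForm.Conservative {X : Type*} [MeasurableSpace X] {μ : Measure X}
    (𝓔 : SymmDirichletForm μ) : Prop :=
  ∃ g : 𝓔.domain, (((g : Lp ℝ 2 μ) : X → ℝ) =ᵐ[μ] fun _ => 1) ∧ 𝓔.form g g = 0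

/-- Notational package for the diagonal of a symmetric form, read on functions: which functions
are in the domain, and the energy `f ↦ 𝓔(f, f)` as an extended nonnegative number.
(All forms below are symmetric, hence determined by the diagonal through polarization.) -/
structure EnergyForm (X : Type*) where
  /-- `f ∈ 𝓓(𝓔)` -/
  dom : (X → ℝ) → Prop
  /-- `𝓔(f, f)` -/
  energy : (X → ℝ) → ℝ≥0∞

/-- The diagonal of a Dirichlet form; a function is in the domain if its class is. The infimum
runs over the (at most one) class in the domain that `f` represents, so that the energy is `∞`
off the domain. -/
def SymmDirichletForm.toEnergyForm {X : Type*} [MeasurableSpace X] {μ : Measure X}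
    (𝓔 : SymmDirichletForm μ) : EnergyForm X where
  dom f := ∃ g : 𝓔.domain, ((g : Lp ℝ 2 μ) : X → ℝ) =ᵐ[μ] f
  energy f := ⨅ (g : 𝓔.domain) (_ : ((g : Lp ℝ 2 μ) : X → ℝ) =ᵐ[μ] f),
    ENNReal.ofReal (𝓔.form g g)

/-- The super Poincaré inequality
`μ(f²) ≤ r 𝓔(f,f) + β(r) μ(|f|)²` for all `r > 0`, `f ∈ 𝓓(𝓔)`, for some
`β : (0,∞) → (0,∞)`. -/
def SuperPoincare {X : Type*} [MeasurableSpace X] (μ : Measure X) (𝓔 : EnergyForm X) : Prop :=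
  ∃ β : ℝ → ℝ, (∀ r, 0 < r → 0 < β r) ∧
    ∀ r, 0 < r → ∀ f : X → ℝ, 𝓔.dom f →
      ∫ x, f x ^ 2 ∂μ ≤ r * (𝓔.energy f).toReal + β r * (∫ x, |f x| ∂μ) ^ 2

/-- The spectral gap `inf {𝓔(f,f) : f ∈ 𝓓(𝓔), μ(f) = 0, μ(f²) = 1}` (`= ∞` if there is no such
`f`). -/
def spectralGap {X : Type*} [MeasurableSpace X] (μ : Measure X) (𝓔 : EnergyForm X) : ℝ≥0∞ :=
  ⨅ (f : X → ℝ) (_ : 𝓔.dom f) (_ : ∫ x, f x ∂μ = 0) (_ : ∫ x, f x ^ 2 ∂μ = 1), 𝓔.energy f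

/-! ### The chain for the number of particles -/

/-- A totally stable, conservative `Q`-matrix on `{0, 1, 2, …}`: nonnegative off-diagonal
entries and row sums `∑ⱼ q i j = 0`, i.e. `- q i i = ∑_{j ≠ i} q i j < ∞`. -/
def IsConservativeQMatrix (q : ℕ → ℕ → ℝ) : Prop :=
  (∀ i j, i ≠ j → 0 ≤ q i j) ∧ ∀ i, HasSum (q i) 0

/-- The measure `∑ₙ ϱₙ δₙ` on `{0, 1, 2, …}`. -/
def natLaw (ϱ : ℕ → ℝ) : Measure ℕ :=
  Measure.sum fun n => ENNReal.ofReal (ϱ n) • Measure.dirac n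

/-- `𝓔_Q(r, r) = ∑_{n} ∑_{m > n} ϱₙ q_{n,m} (rₙ - r_m)²`, where `m = n + k + 1`. -/
def chainEnergy (q : ℕ → ℕ → ℝ) (ϱ : ℕ → ℝ) (r : ℕ → ℝ) : ℝ≥0∞ :=
  ∑' n : ℕ, ∑' k : ℕ, ENNReal.ofReal (ϱ n * q n (n + (k + 1))) *
    ENNReal.ofReal ((r n - r (n + (k + 1))) ^ 2)

/-- The form `𝓔_Q` with domain `{r ∈ L²(ϱ) : 𝓔_Q(r, r) < ∞}`. -/
def chainForm (q : ℕ → ℕ → ℝ) (ϱ : ℕ → ℝ) : EnergyForm ℕ where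
  dom r := MemLp r 2 (natLaw ϱ) ∧ chainEnergy q ϱ r < ∞
  energy := chainEnergy q ϱ

/-! ### Finite configurations -/

section Configurations

variable {E : Type*} [TopologicalSpace E] [MeasurableSpace E] [OpensMeasurableSpace E]

/-- `∑ᵢ δ_{xᵢ}` as a finite measure. -/
def sumDirac {n : ℕ} (x : Fin n → E) : FiniteMeasure E :=
  ⟨∑ i, Measure.dirac (x i), inferInstance⟩

variable (E) in
/-- The space `Γ₀` of finite (multiple) configurations: all measures `∑_{i<n} δ_{xᵢ}`, `n ≥ 0`. -/
def FinConf : Type _ := {γ : FiniteMeasure E // ∃ (n : ℕ) (x : Fin n → E), γ = sumDirac x}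

/-- A configuration, as a finite measure. -/
def FinConf.toFiniteMeasure (γ : FinConf E) : FiniteMeasure E := γ.1

/-- The topology of weak convergence on `Γ₀`. -/
instance : TopologicalSpace (FinConf E) :=
  TopologicalSpace.induced FinConf.toFiniteMeasure inferInstance

/-- The Borel `σ`-field of `Γ₀`. -/
instance : MeasurableSpace (FinConf E) := borel _

instance : BorelSpace (FinConf E) := ⟨rfl⟩

/-- The map `φₙ : Eⁿ → Γ₀`, `φₙ(x) = ∑ᵢ δ_{xᵢ}`. -/
def conf {n : ℕ} (x : Fin n → E) : FinConf E := ⟨sumDirac x, n, x, rfl⟩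

/-- Adding the particles `x₁, …, x_k` to a configuration: `γ + φ_k(x)`. -/
def FinConf.addParticles {k : ℕ} (γ : FinConf E) (x : Fin k → E) : FinConf E :=
  ⟨γ.1 + sumDirac x, by
    obtain ⟨n, y, hy⟩ := γ.2
    refine ⟨n + k, Fin.append y x, ?_⟩
    apply Subtype.ext
    rw [hy]
    change (∑ i, Measure.dirac (y i)) + (∑ i, Measure.dirac (x i)) =
      ∑ i, Measure.dirac (Fin.append y x i)
    rw [Fin.sum_univ_add]
    simp⟩

/-- The measure `π_{μ,ϱ} = ∑ₙ ϱₙ μ⁽ⁿ⁾ ∘ φₙ⁻¹` on `Γ₀` (`μ⁽⁰⁾` lives on the one-point space `E⁰`, so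
the term with `n = 0` is `ϱ₀ δ₀` when `μ⁽⁰⁾` is a probability measure). -/
def confLaw (ϱ : ℕ → ℝ) (μ : ∀ n : ℕ, Measure (Fin n → E)) : Measure (FinConf E) :=
  Measure.sum fun n => ENNReal.ofReal (ϱ n) • (μ n).map conf

/-- `κ n k y` is a version of the law `μₙ⁽ⁿ⁺ᵏ⁾(y, ·)` on `Eᵏ` of `k` newborn particles, given `n`
particles at `y₁, …, yₙ`: it is symmetric in `y`, it disintegrates the reference measures,
`μ⁽ⁿ⁺ᵏ⁾(dy dx) = μ⁽ⁿ⁾(dy) μₙ⁽ⁿ⁺ᵏ⁾(y; dx)`, and `μₙ⁽ⁿ⁺ᵏ⁾(y, ·)` is absolutely continuous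
with respect to `μ⁽ᵏ⁾`, for every `y`. -/
structure IsBirthKernel (μ : ∀ n : ℕ, Measure (Fin n → E))
    (κ : ∀ n k : ℕ, Kernel (Fin n → E) (Fin k → E)) : Prop where
  symm : ∀ n k (σ : Equiv.Perm (Fin n)) (y : Fin n → E), κ n k (y ∘ σ) = κ n k y
  disintegration : ∀ n k, (μ n ⊗ₘ κ n k).map (fun p => Fin.append p.1 p.2) = μ (n + k)
  absolutelyContinuous : ∀ n k (y : Fin n → E), κ n k y ≪ μ k

/-! ### The reaction form -/

/-- `𝓔_R(F, F) = ∑ₙ ∑_{m > n} ϱₙ q_{n,m} ∫ μ⁽ⁿ⁾(dy) ∫ (F(γ + φ_{m-n}(x)) - F(γ))² μₙ⁽ᵐ⁾(γ, dx)`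
with `γ = φₙ(y)` and `m = n + k + 1`. -/
def reactionEnergy (q : ℕ → ℕ → ℝ) (ϱ : ℕ → ℝ) (μ : ∀ n : ℕ, Measure (Fin n → E))
    (κ : ∀ n k : ℕ, Kernel (Fin n → E) (Fin k → E)) (F : FinConf E → ℝ) : ℝ≥0∞ :=
  ∑' n : ℕ, ∑' k : ℕ, ENNReal.ofReal (ϱ n * q n (n + (k + 1))) *
    ∫⁻ y, ∫⁻ x, ENNReal.ofReal ((F ((conf y).addParticles x) - F (conf y)) ^ 2)
      ∂(κ n (k + 1) y) ∂(μ n)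

/-- The reaction form, with domain `{F ∈ L²(π_{μ,ϱ}) : 𝓔_R(F, F) < ∞}`. -/
def reactionForm (q : ℕ → ℕ → ℝ) (ϱ : ℕ → ℝ) (μ : ∀ n : ℕ, Measure (Fin n → E))
    (κ : ∀ n k : ℕ, Kernel (Fin n → E) (Fin k → E)) : EnergyForm (FinConf E) where
  dom F := MemLp F 2 (confLaw ϱ μ) ∧ reactionEnergy q ϱ μ κ F < ∞
  energy := reactionEnergy q ϱ μ κ

/-! ### The diffusion form -/

/-- `𝓔₀^{Γ₀}(F, F) = ∑_{n ≥ 1} ϱₙ 𝓔₀⁽ⁿ⁾(F⁽ⁿ⁾, F⁽ⁿ⁾)`, where `F⁽ⁿ⁾ = F ∘ φₙ`, for given forms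
`𝓔₀⁽ⁿ⁾` on `Eⁿ`. -/
def diffusionEnergy (ϱ : ℕ → ℝ) (𝓔 : ∀ n : ℕ, EnergyForm (Fin n → E)) (F : FinConf E → ℝ) :
    ℝ≥0∞ :=
  ∑' n : ℕ, ENNReal.ofReal (ϱ (n + 1)) * (𝓔 (n + 1)).energy (fun x => F (conf x))

/-- The diffusion form, with domain
`{F ∈ L²(π_{μ,ϱ}) : F⁽ⁿ⁾ ∈ 𝓓(𝓔₀⁽ⁿ⁾) for n ≥ 1, 𝓔₀^{Γ₀}(F, F) < ∞}`. -/
def diffusionForm (ϱ : ℕ → ℝ) (μ : ∀ n : ℕ, Measure (Fin n → E))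
    (𝓔 : ∀ n : ℕ, EnergyForm (Fin n → E)) : EnergyForm (FinConf E) where
  dom F := MemLp F 2 (confLaw ϱ μ) ∧ (∀ n : ℕ, 1 ≤ n → (𝓔 n).dom fun x => F (conf x)) ∧
    diffusionEnergy ϱ 𝓔 F < ∞
  energy := diffusionEnergy ϱ 𝓔

end Configurations

/-- The sum of two forms, on the intersection of their domains. -/
def EnergyForm.sum {X : Type*} (𝓔₁ 𝓔₂ : EnergyForm X) : EnergyForm X where
  dom f := 𝓔₁.dom f ∧ 𝓔₂.dom f
  energy f := 𝓔₁.energy f + 𝓔₂.energy f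

/-! ### Independent particles -/

section Independent

variable {E : Type*} [MeasurableSpace E] {ν : Measure E}

/-- The product measures `μ⁽ⁿ⁾ = νⁿ` on `Eⁿ`. -/
def powerLaw (ν : Measure E) [IsProbabilityMeasure ν] (n : ℕ) : Measure (Fin n → E) :=
  Measure.pi fun _ => ν

/-- The infinite product measure on `E^ℕ`. -/
def infLaw (ν : Measure E) [IsProbabilityMeasure ν] : Measure (ℕ → E) :=
  Measure.infinitePi fun _ => ν

/-- `f_{x|i}(y) = f(x₁, …, x_{i-1}, y, x_{i+1}, …)`. -/
def coordSlice (f : (ℕ → E) → ℝ) (x : ℕ → E) (i : ℕ) : E → ℝ :=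
  fun y => f (Function.update x i y)

/-- `𝓔₀(f, f) = ∑ᵢ ∫ 𝓔₀⁽¹⁾(f_{x|i}, f_{x|i}) μ(dx)`. -/
def infEnergy [IsProbabilityMeasure ν] (𝓔 : SymmDirichletForm ν) (f : (ℕ → E) → ℝ) : ℝ≥0∞ :=
  ∑' i : ℕ, ∫⁻ x, 𝓔.toEnergyForm.energy (coordSlice f x i) ∂(infLaw ν)

/-- The form `𝓔₀` of infinitely many independent particles on `L²(E^ℕ; ν^ℕ)`, with domain
`{f ∈ L² : f_{x|i} ∈ 𝓓(𝓔₀⁽¹⁾) for a.e. x and all i, 𝓔₀(f, f) < ∞}`. -/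
def infForm [IsProbabilityMeasure ν] (𝓔 : SymmDirichletForm ν) : EnergyForm (ℕ → E) where
  dom f := MemLp f 2 (infLaw ν) ∧
    (∀ i, ∀ᵐ x ∂(infLaw ν), 𝓔.toEnergyForm.dom (coordSlice f x i)) ∧ infEnergy 𝓔 f < ∞
  energy := infEnergy 𝓔

/-- The forms `𝓔₀⁽ⁿ⁾` of `n` independent particles on `L²(Eⁿ; νⁿ)`: the restriction of `𝓔₀` to
functions of the first `n` coordinates. -/
def powerForm [IsProbabilityMeasure ν] (𝓔 : SymmDirichletForm ν) (n : ℕ) :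
    EnergyForm (Fin n → E) where
  dom f := MemLp f 2 (powerLaw ν n) ∧ (infForm 𝓔).dom fun x => f fun i => x i
  energy f := (infForm 𝓔).energy fun x => f fun i => x i

end Independent

end

open scoped NNReal

noncomputable section

/-! ### Lower semicontinuity of a Dirichlet form and its epigraph -/

namespace SymmDirichletForm

variable {X : Type*} [MeasurableSpace X] {μ : Measure X} (𝓔 : SymmDirichletForm μ)

/-! Necessity is a matter of test functions. A function of the number of particles alone has zero
diffusion energy, because the one-particle form is conservative, and its reaction energy is the
chain energy; this gives the inequality for $\mathscr E_Q$. For $\mathscr E_0^{(1)}$, take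
$F(\delta_x)=f(x)$ and $F=0$ when the number of particles is not one (`oneParticle`). Only jumps
into or out of level one contribute to its reaction energy, which is therefore at most $C\,\nu(f^2)$
with $C<\infty$ by total stability (`reactionEnergy_oneParticle_le`). With a small parameter in the
inequality, this term is absorbed on the left.

For sufficiency, let $r_n$ be the $L^2(\nu^n)$ norm of $F^{(n)}$. Then $\varrho(\mathbf
r^2)=\pi(F^2)$. The birth kernel disintegrates $\nu^m$, so $r_n$ and $r_m$ are norms in one common
$L^2$ space, and the reverse triangle inequality gives $\mathscr E_Q(\mathbf r,\mathbf r)\le\mathscr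
E_R(F,F)$ (`chainEnergy_le_reactionEnergy`). In the chain inequality the tail of $\varrho(|\mathbf
r|)$ is absorbed by Cauchy–Schwarz, so that only finitely many $r_n^2$ remain
(`exists_chain_truncation`). Those are controlled by the super Poincaré inequality on $E^n$, and
$\varrho_n\nu^n(|F^{(n)}|)\le\pi(|F|)$.

The inequality on $E^n$ comes from tensorization (`exists_lintegral_sq_le_pi`): average $|f|$ over
some coordinates and apply the one-particle inequality in the next one. This needs the energy of an
average to be at most the average energy (`energy_integral_le`, Jensen on the closed convex
epigraph) and the energy of $|f|$ to be at most a multiple of that of $f$ (`energy_abs_le`). -/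

lemma form_add_self (f g : 𝓔.domain) :
    𝓔.form (f + g) (f + g) = 𝓔.form f f + 2 * 𝓔.form f g + 𝓔.form g g := by
  simp only [map_add, LinearMap.add_apply]
  rw [𝓔.symm g f]; ring

lemma form_sub_self (f g : 𝓔.domain) :
    𝓔.form (f - g) (f - g) = 𝓔.form f f - 2 * 𝓔.form f g + 𝓔.form g g := by
  simp only [map_sub, LinearMap.sub_apply]
  rw [𝓔.symm g f]; ring

lemma form_smul_self (c : ℝ) (f : 𝓔.domain) : 𝓔.form (c • f) (c • f) = c ^ 2 * 𝓔.form f f := by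
  simp only [map_smul, LinearMap.smul_apply, smul_eq_mul]; ring

lemma form_add_le (ε : ℝ) (hε : 0 < ε) (f g : 𝓔.domain) :
    𝓔.form (f + g) (f + g) ≤ (1 + ε) * 𝓔.form f f + (1 + ε⁻¹) * 𝓔.form g g := by
  have h := 𝓔.nonneg (ε • f - g)
  rw [form_sub_self, form_smul_self] at h
  simp only [map_smul, LinearMap.smul_apply, smul_eq_mul] at h
  rw [form_add_self]
  have : 2 * 𝓔.form f g ≤ ε * 𝓔.form f f + ε⁻¹ * 𝓔.form g g := by
    have h2 : 0 ≤ ε⁻¹ * (ε ^ 2 * 𝓔.form f f - 2 * (ε * 𝓔.form f g) + 𝓔.form g g) :=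
      mul_nonneg (inv_nonneg.2 hε.le) h
    have h3 : ε⁻¹ * (ε ^ 2 * 𝓔.form f f - 2 * (ε * 𝓔.form f g) + 𝓔.form g g)
      = ε * 𝓔.form f f - 2 * 𝓔.form f g + ε⁻¹ * 𝓔.form g g := by
      field_simp
    linarith
  linarith

/-- The form is lower semicontinuous on `L²`, with the value `∞` off the domain. -/
theorem mem_domain_of_approx (v : Lp ℝ 2 μ) (C : ℝ)
    (h : ∀ δ > 0, ∃ w : 𝓔.domain, ‖(w : Lp ℝ 2 μ) - v‖ < δ ∧ 𝓔.form w w ≤ C + δ) :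
    ∃ g : 𝓔.domain, (g : Lp ℝ 2 μ) = v ∧ 𝓔.form g g ≤ C := by
  set S : ℝ → Set ℝ := fun δ => {t | ∃ w : 𝓔.domain, ‖(w : Lp ℝ 2 μ) - v‖ < δ ∧ 𝓔.form w w = t}
    with hS
  have hbdd : ∀ δ, BddBelow (S δ) := fun δ => ⟨0, by rintro _ ⟨w, -, rfl⟩; exact 𝓔.nonneg w⟩
  have hne : ∀ δ > 0, (S δ).Nonempty := fun δ hδ => by
    obtain ⟨w, hw, -⟩ := h δ hδ
    exact ⟨_, w, hw, rfl⟩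
  set d : ℕ → ℝ := fun n => 1 / ((n : ℝ) + 1) with hd
  have hd0 : ∀ n, 0 < d n := fun n => by positivity
  have hdanti : ∀ {m n}, m ≤ n → d n ≤ d m := fun hmn => Nat.one_div_le_one_div hmn
  have hdlim : Tendsto d atTop (𝓝 0) := tendsto_one_div_add_atTop_nhds_zero_nat
  -- The least energy in the ball of radius `d n` about `v` increases with `n` and stays below `C`.
  -- Near-minimizers `w n` will be Cauchy for the form, by the parallelogram identity; no weak
  -- compactness is needed.
  set I : ℕ → ℝ := fun n => sInf (S (d n)) with hI
  have hmono : Monotone I := fun m n hmn =>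
    csInf_le_csInf (hbdd _) (hne _ (hd0 n)) fun t ⟨w, hw, hwt⟩ => ⟨w, hw.trans_le (hdanti hmn), hwt⟩
  have hIC : ∀ n, I n ≤ C := fun n => by
    refine le_of_forall_pos_le_add fun ε hε => ?_
    obtain ⟨w, hw, hwC⟩ := h (min ε (d n)) (lt_min hε (hd0 n))
    exact (csInf_le (hbdd _) ⟨w, hw.trans_le (min_le_right _ _), rfl⟩).trans
      (hwC.trans (by linarith [min_le_left ε (d n)]))
  have hw : ∀ n, ∃ w : 𝓔.domain, ‖(w : Lp ℝ 2 μ) - v‖ < d n ∧ 𝓔.form w w < I n + d n := fun n => by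
    obtain ⟨t, ⟨w, hw, rfl⟩, ht⟩ := exists_lt_of_csInf_lt (hne _ (hd0 n))
      (lt_add_of_pos_right (I n) (hd0 n))
    exact ⟨w, hw, ht⟩
  choose w hwv hwI using hw
  obtain ⟨Lim, hLim⟩ : ∃ l, Tendsto I atTop (𝓝 l) :=
    ⟨_, tendsto_atTop_ciSup hmono ⟨C, by rintro _ ⟨n, rfl⟩; exact hIC n⟩⟩
  have hILim : ∀ n, I n ≤ Lim := fun n => hmono.ge_of_tendsto hLim n
  have hcauchy : ∀ N, ∀ m, N ≤ m → ∀ n, N ≤ n →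
      ‖w m - w n‖ ^ 2 + 𝓔.form (w m - w n) (w m - w n) ≤
        (2 * d N) ^ 2 + (4 * (Lim - I N) + 4 * d N) := fun N m hm n hn => by
    have h1 : ‖w m - w n‖ ≤ 2 * d N := by
      have : ‖w m - w n‖ = ‖((w m : Lp ℝ 2 μ) - v) - ((w n : Lp ℝ 2 μ) - v)‖ := by
        rw [sub_sub_sub_cancel_right]; rfl
      rw [this]
      refine (norm_sub_le _ _).trans ?_
      linarith [hwv m, hwv n, hdanti hm, hdanti hn]
    -- The midpoint of `w m` and `w n` is still in the ball of radius `d N`, so its energy cannot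
    -- fall below the infimum there.
    have h2 : I N ≤ 𝓔.form ((2⁻¹ : ℝ) • (w m + w n)) ((2⁻¹ : ℝ) • (w m + w n)) := by
      refine csInf_le (hbdd _) ⟨_, ?_, rfl⟩
      have : (((2⁻¹ : ℝ) • (w m + w n) : 𝓔.domain) : Lp ℝ 2 μ) - v =
          (2⁻¹ : ℝ) • (((w m : Lp ℝ 2 μ) - v) + ((w n : Lp ℝ 2 μ) - v)) := by
        push_cast
        module
      rw [this, norm_smul]
      have := norm_add_le ((w m : Lp ℝ 2 μ) - v) ((w n : Lp ℝ 2 μ) - v)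
      norm_num
      linarith [hwv m, hwv n, hdanti hm, hdanti hn]
    rw [form_smul_self, form_add_self] at h2
    rw [form_sub_self]
    have h3 : ‖w m - w n‖ ^ 2 ≤ (2 * d N) ^ 2 := pow_le_pow_left₀ (norm_nonneg _) h1 2
    linarith [hwI m, hwI n, hILim m, hILim n, hdanti hm, hdanti hn]
  have hlim0 : Tendsto (fun N => (2 * d N) ^ 2 + (4 * (Lim - I N) + 4 * d N)) atTop (𝓝 0) := by
    have := ((hdlim.const_mul 2).pow 2).add
      (((hLim.const_sub Lim).const_mul 4).add (hdlim.const_mul 4))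
    simpa using this
  obtain ⟨f, hf⟩ := 𝓔.closed w fun ε hε => by
    obtain ⟨N, hN⟩ := (hlim0.eventually_lt_const hε).exists
    exact ⟨N, fun m hm n hn => (hcauchy N m hm n hn).trans_lt hN⟩
  have hf1 : Tendsto (fun n => ‖w n - f‖ ^ 2) atTop (𝓝 0) :=
    squeeze_zero (fun n => by positivity) (fun n => by linarith [𝓔.nonneg (w n - f)]) hf
  have hf2 : Tendsto (fun n => 𝓔.form (w n - f) (w n - f)) atTop (𝓝 0) :=
    squeeze_zero (fun n => 𝓔.nonneg _) (fun n => by linarith [sq_nonneg ‖w n - f‖]) hf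
  have hfw : Tendsto (fun n => (w n : Lp ℝ 2 μ)) atTop (𝓝 (f : Lp ℝ 2 μ)) := by
    rw [tendsto_iff_norm_sub_tendsto_zero]
    have := hf1.sqrt
    simpa [Real.sqrt_sq] using this
  have hvw : Tendsto (fun n => (w n : Lp ℝ 2 μ)) atTop (𝓝 v) := by
    rw [tendsto_iff_norm_sub_tendsto_zero]
    exact squeeze_zero (fun n => norm_nonneg _) (fun n => (hwv n).le) hdlim
  refine ⟨f, tendsto_nhds_unique hfw hvw, ?_⟩
  -- A weighted Young inequality for `f = w n + (f - w n)`, followed by `n → ∞` and then `ε → 0`,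
  -- replaces the triangle inequality for the square root of the form.
  have key : ∀ ε > 0, 𝓔.form f f ≤ (1 + ε) * C := fun ε hε => by
    have h1 : ∀ n, 𝓔.form f f ≤ (1 + ε) * (C + d n) + (1 + ε⁻¹) * 𝓔.form (w n - f) (w n - f) :=
      fun n => by
        have h2 := 𝓔.form_add_le ε hε (w n) (f - w n)
        rw [add_sub_cancel] at h2
        have h3 : 𝓔.form (f - w n) (f - w n) = 𝓔.form (w n - f) (w n - f) := by
          rw [form_sub_self, form_sub_self, 𝓔.symm f (w n)]; ring
        rw [h3] at h2
        have h4 : 𝓔.form (w n) (w n) ≤ C + d n := by linarith [hwI n, hIC n]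
        have := mul_le_mul_of_nonneg_left h4 (by positivity : 0 ≤ 1 + ε)
        linarith
    have h2 := ((hdlim.const_add C).const_mul (1 + ε)).add (hf2.const_mul (1 + ε⁻¹))
    simpa using ge_of_tendsto' h2 h1
  have hlim : Tendsto (fun ε : ℝ => (1 + ε) * C) (𝓝[>] 0) (𝓝 C) := by
    have : Tendsto (fun ε : ℝ => (1 + ε) * C) (𝓝 0) (𝓝 ((1 + 0) * C)) :=
      (continuous_const.add continuous_id).mul continuous_const |>.tendsto 0
    simpa using this.mono_left nhdsWithin_le_nhds
  exact ge_of_tendsto hlim (eventually_nhdsWithin_of_forall fun ε hε => key ε hε)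

/-- The epigraph of the form in `L² × ℝ`. -/
def epigraph : Set (Lp ℝ 2 μ × ℝ) := {p | ∃ g : 𝓔.domain, (g : Lp ℝ 2 μ) = p.1 ∧ 𝓔.form g g ≤ p.2}

/-- Closedness and convexity together keep barycentres inside the epigraph, which is Jensen's
inequality for the form. -/
lemma isClosed_epigraph : IsClosed 𝓔.epigraph := by
  refine isClosed_of_closure_subset fun p hp => ?_
  refine 𝓔.mem_domain_of_approx p.1 p.2 fun δ hδ => ?_
  obtain ⟨q, ⟨g, hg, hgq⟩, hq⟩ := Metric.mem_closure_iff.1 hp δ hδ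
  rw [dist_comm, Prod.dist_eq, max_lt_iff, dist_eq_norm, Real.dist_eq] at hq
  exact ⟨g, hg ▸ hq.1, by linarith [le_abs_self (q.2 - p.2), hq.2]⟩

lemma convex_epigraph : Convex ℝ 𝓔.epigraph := by
  rintro ⟨_, s⟩ ⟨f, rfl, hf⟩ ⟨_, t⟩ ⟨g, rfl, hg⟩ a b ha hb hab
  refine ⟨a • f + b • g, by simp, ?_⟩
  have h := mul_nonneg (mul_nonneg ha hb) (𝓔.nonneg (f - g))
  rw [form_sub_self] at h
  rw [form_add_self, form_smul_self, form_smul_self]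
  simp only [map_smul, LinearMap.smul_apply, smul_eq_mul, Prod.snd_add, Prod.smul_snd] at *
  have h1 := mul_le_mul_of_nonneg_left hf ha
  have h2 := mul_le_mul_of_nonneg_left hg hb
  obtain rfl : b = 1 - a := by linarith
  nlinarith

end SymmDirichletForm

/-! ### The energy as a function on `L²`; positive part and absolute value -/

namespace SymmDirichletForm

variable {X : Type*} [MeasurableSpace X] {μ : Measure X} (𝓔 : SymmDirichletForm μ)

lemma energy_congr {f f' : X → ℝ} (h : f =ᵐ[μ] f') :
    𝓔.toEnergyForm.energy f = 𝓔.toEnergyForm.energy f' := by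
  have : ∀ g : 𝓔.domain, ((g : Lp ℝ 2 μ) : X → ℝ) =ᵐ[μ] f ↔ ((g : Lp ℝ 2 μ) : X → ℝ) =ᵐ[μ] f' :=
    fun g => ⟨fun hg => hg.trans h, fun hg => hg.trans h.symm⟩
  simp only [toEnergyForm, this]

lemma energy_eq {f : X → ℝ} (g : 𝓔.domain) (hg : ((g : Lp ℝ 2 μ) : X → ℝ) =ᵐ[μ] f) :
    𝓔.toEnergyForm.energy f = ENNReal.ofReal (𝓔.form g g) := by
  refine le_antisymm (iInf₂_le g hg) (le_iInf₂ fun g' hg' => ?_)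
  obtain rfl : g' = g := Subtype.ext (Lp.ext (hg'.trans hg.symm))
  exact le_rfl

lemma exists_of_energy_ne_top {f : X → ℝ} (h : 𝓔.toEnergyForm.energy f ≠ ∞) :
    ∃ g : 𝓔.domain, ((g : Lp ℝ 2 μ) : X → ℝ) =ᵐ[μ] f := by
  by_contra! H
  exact h (iInf₂_eq_top.2 fun g hg => (H g hg).elim)

lemma dom_iff_energy_lt_top {f : X → ℝ} :
    𝓔.toEnergyForm.dom f ↔ 𝓔.toEnergyForm.energy f < ∞ := by
  refine ⟨fun ⟨g, hg⟩ => ?_, fun h => 𝓔.exists_of_energy_ne_top h.ne⟩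
  rw [𝓔.energy_eq g hg]; exact ENNReal.ofReal_lt_top

lemma memLp_of_dom {f : X → ℝ} (h : 𝓔.toEnergyForm.dom f) : MemLp f 2 μ := by
  obtain ⟨g, hg⟩ := h
  exact (memLp_congr_ae hg).1 (Lp.memLp _)

lemma energy_const (h : 𝓔.Conservative) (c : ℝ) : 𝓔.toEnergyForm.energy (fun _ => c) = 0 := by
  obtain ⟨g, hg, h0⟩ := h
  rw [𝓔.energy_eq (c • g), form_smul_self, h0]
  · simp
  · refine (Lp.coeFn_smul c (g : Lp ℝ 2 μ)).trans ?_
    filter_upwards [hg] with x hx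
    simp [hx]

lemma energy_le_iff_mem_epigraph (f : Lp ℝ 2 μ) (c : ℝ) (hc : 0 ≤ c) :
    𝓔.toEnergyForm.energy f ≤ ENNReal.ofReal c ↔ (f, c) ∈ 𝓔.epigraph := by
  constructor
  · intro h
    obtain ⟨g, hg⟩ := 𝓔.exists_of_energy_ne_top (h.trans_lt ENNReal.ofReal_lt_top).ne
    rw [𝓔.energy_eq g hg, ENNReal.ofReal_le_ofReal_iff hc] at h
    exact ⟨g, Lp.ext hg, h⟩
  · rintro ⟨g, hg, hgc⟩
    rw [𝓔.energy_eq g (by rw [hg])]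
    exact ENNReal.ofReal_le_ofReal hgc

lemma lowerSemicontinuous_energy :
    LowerSemicontinuous fun f : Lp ℝ 2 μ => 𝓔.toEnergyForm.energy f := by
  refine lowerSemicontinuous_iff_isClosed_preimage.2 fun c => ?_
  rcases eq_or_ne c ∞ with rfl | hc
  · simp
  have : (fun f : Lp ℝ 2 μ => 𝓔.toEnergyForm.energy f) ⁻¹' Set.Iic c =
      (fun f : Lp ℝ 2 μ => (f, c.toReal)) ⁻¹' 𝓔.epigraph := by
    ext f
    rw [Set.mem_preimage, Set.mem_preimage, ← 𝓔.energy_le_iff_mem_epigraph _ _ ENNReal.toReal_nonneg,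
      ENNReal.ofReal_toReal hc]
    rfl
  rw [this]
  exact 𝓔.isClosed_epigraph.preimage (by fun_prop)

/-- The positive part operates on a Dirichlet form. -/
lemma exists_posPart (g : 𝓔.domain) : ∃ h : 𝓔.domain,
    (((h : Lp ℝ 2 μ) : X → ℝ) =ᵐ[μ] fun x => max (((g : Lp ℝ 2 μ) : X → ℝ) x) 0) ∧
      𝓔.form h h ≤ 𝓔.form g g := by
  set u : X → ℝ := ((g : Lp ℝ 2 μ) : X → ℝ) with hu
  have hum : MemLp u 2 μ := Lp.memLp _
  have hpm : MemLp (fun x => max (u x) 0) 2 μ := hum.pos_part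
  -- The unit contraction applied to `g / (n + 1)` and scaled back truncates the positive part at `n
  -- + 1`. These truncations converge in `L²` by domination, and semicontinuity carries the energy
  -- bound to the limit.
  have hk : ∀ n : ℕ, ∃ k : 𝓔.domain,
      (((k : Lp ℝ 2 μ) : X → ℝ) =ᵐ[μ] fun x => min (max (u x) 0) (n + 1)) ∧
        𝓔.form k k ≤ 𝓔.form g g := fun n => by
    have hn : (0 : ℝ) < n + 1 := by positivity
    obtain ⟨k, hk, hke⟩ := 𝓔.markov (((n : ℝ) + 1)⁻¹ • g)
    refine ⟨((n : ℝ) + 1) • k, ?_, ?_⟩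
    · refine (Lp.coeFn_smul ((n : ℝ) + 1) (k : Lp ℝ 2 μ)).trans ?_
      filter_upwards [hk, Lp.coeFn_smul ((n : ℝ) + 1)⁻¹ (g : Lp ℝ 2 μ)] with x hx hx2
      have hx3 : (((((n : ℝ) + 1)⁻¹ • g : 𝓔.domain) : Lp ℝ 2 μ) : X → ℝ) x =
        ((n : ℝ) + 1)⁻¹ * u x := hx2
      rw [Pi.smul_apply, hx, hx3, smul_eq_mul, mul_min_of_nonneg _ _ hn.le,
        mul_max_of_nonneg _ _ hn.le, mul_inv_cancel_left₀ hn.ne']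
      simp
    · rw [form_smul_self] at hke ⊢
      calc _ ≤ ((n : ℝ) + 1) ^ 2 * ((((n : ℝ) + 1)⁻¹) ^ 2 * 𝓔.form g g) :=
            mul_le_mul_of_nonneg_left hke (by positivity)
        _ = _ := by field_simp
  choose k hk hke using hk
  have hlim : Tendsto (fun n => (k n : Lp ℝ 2 μ)) atTop (𝓝 (hpm.toLp _)) := by
    rw [Lp.tendsto_Lp_iff_tendsto_eLpNorm']
    have h2 : ∀ n, eLpNorm ((k n : Lp ℝ 2 μ) - hpm.toLp _ : X → ℝ) 2 μ ^ (2 : ℝ) =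
        ∫⁻ x, ‖min (max (u x) 0) ((n : ℝ) + 1) - max (u x) 0‖ₑ ^ (2 : ℝ) ∂μ := fun n => by
      rw [eLpNorm_eq_lintegral_rpow_enorm_toReal (by norm_num) (by norm_num)]
      simp only [ENNReal.toReal_ofNat]
      rw [← ENNReal.rpow_mul]
      norm_num
      refine lintegral_congr_ae ?_
      filter_upwards [hk n, hpm.coeFn_toLp] with x hx hx2
      rw [hx, hx2]
    have h3 : Tendsto (fun n : ℕ =>
        ∫⁻ x, ‖min (max (u x) 0) ((n : ℝ) + 1) - max (u x) 0‖ₑ ^ (2 : ℝ) ∂μ) atTop (𝓝 0) := by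
      have hsm : AEStronglyMeasurable (fun x => max (u x) 0) μ := hpm.1
      have h4 := tendsto_lintegral_of_dominated_convergence' (μ := μ)
        (F := fun (n : ℕ) x => ‖min (max (u x) 0) ((n : ℝ) + 1) - max (u x) 0‖ₑ ^ (2 : ℝ))
        (f := fun _ => 0) (fun x => ‖u x‖ₑ ^ (2 : ℝ)) (fun n => ?_) (fun n => ?_) ?_ ?_
      · simpa using h4
      · exact (((hsm.aemeasurable.min aemeasurable_const).sub hsm.aemeasurable).enorm).pow_const _
      · refine ae_of_all _ fun x => ?_
        refine ENNReal.rpow_le_rpow ?_ (by norm_num)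
        rw [Real.enorm_eq_ofReal_abs, Real.enorm_eq_ofReal_abs]
        refine ENNReal.ofReal_le_ofReal ?_
        have hn : (0 : ℝ) < n + 1 := by positivity
        rcases le_total (u x) 0 with h | h
        · simp [max_eq_right h, min_eq_left hn.le]
        · rw [max_eq_left h]
          rcases le_total (u x) (n + 1) with h' | h'
          · simp [min_eq_left h']
          · rw [min_eq_right h', abs_of_nonpos (by linarith), abs_of_nonneg h]; linarith
      · have := lintegral_rpow_enorm_lt_top_of_eLpNorm_lt_top (p := 2) (by norm_num) (by norm_num)
          hum.2
        simpa using this.ne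
      · refine ae_of_all _ fun x => tendsto_const_nhds.congr' ?_
        filter_upwards [eventually_ge_atTop ⌈max (u x) 0⌉₊] with n hn
        have : max (u x) 0 ≤ (n : ℝ) + 1 := (Nat.le_ceil _).trans
          ((Nat.cast_le.2 hn).trans (by linarith))
        simp [min_eq_left this]
    have h5 := (ENNReal.continuous_rpow_const (y := (2⁻¹ : ℝ))).tendsto 0 |>.comp
      ((tendsto_congr h2).2 h3)
    have h6 : (fun n => eLpNorm ((k n : Lp ℝ 2 μ) - hpm.toLp _ : X → ℝ) 2 μ) = 
      (fun x : ℝ≥0∞ => x ^ (2⁻¹ : ℝ)) ∘ 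
        fun n => eLpNorm ((k n : Lp ℝ 2 μ) - hpm.toLp _ : X → ℝ) 2 μ ^ (2 : ℝ) := by
      funext n
      simp only [Function.comp]
      rw [← ENNReal.rpow_mul]; norm_num
    rw [h6]
    simpa using h5
  obtain ⟨h, hh, hhe⟩ := 𝓔.mem_domain_of_approx (hpm.toLp _) (𝓔.form g g) fun δ hδ => by
    obtain ⟨n, hn⟩ := (Metric.tendsto_nhds.1 hlim δ hδ).exists
    exact ⟨k n, by rwa [← dist_eq_norm], (hke n).trans (by linarith)⟩
  exact ⟨h, by rw [hh]; exact hpm.coeFn_toLp, hhe⟩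

/-- With `g = p - m` split into positive and negative parts, the parallelogram identity gives `𝓔(p +
m) = 2𝓔(p) + 2𝓔(m) - 𝓔(g)`, hence the factor `2 + 2 - 1`. The sharp constant is not needed, since
the super Poincaré inequality holds for every parameter. -/
lemma energy_abs_le (f : X → ℝ) :
    𝓔.toEnergyForm.energy (fun x => |f x|) ≤ 3 * 𝓔.toEnergyForm.energy f := by
  rcases eq_or_ne (𝓔.toEnergyForm.energy f) ∞ with h | h
  · rw [h]; simp
  obtain ⟨g, hg⟩ := 𝓔.exists_of_energy_ne_top h
  obtain ⟨p, hp, hpe⟩ := 𝓔.exists_posPart g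
  obtain ⟨m, hm, hme⟩ := 𝓔.exists_posPart (-g)
  have hneg : 𝓔.form (-g) (-g) = 𝓔.form g g := by simp
  rw [hneg] at hme
  have hae : ((-g : 𝓔.domain) : Lp ℝ 2 μ) =ᵐ[μ] fun x => - ((g : Lp ℝ 2 μ) : X → ℝ) x :=
    Lp.coeFn_neg _
  have hpm : p - m = g := by
    refine Subtype.ext (Lp.ext ?_)
    refine (Lp.coeFn_sub _ _).trans ?_
    filter_upwards [hp, hm, hae] with x h1 h2 h3
    rw [Pi.sub_apply, h1, h2, h3]
    exact max_zero_sub_max_neg_zero_eq_self _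
  have habs : ((p + m : 𝓔.domain) : Lp ℝ 2 μ) =ᵐ[μ] fun x => |f x| := by
    refine (Lp.coeFn_add _ _).trans ?_
    filter_upwards [hp, hm, hae, hg] with x h1 h2 h3 h4
    rw [Pi.add_apply, h1, h2, h3, ← h4]
    rcases le_total (((g : Lp ℝ 2 μ) : X → ℝ) x) 0 with h | h
    · rw [max_eq_right h, max_eq_left (by linarith), abs_of_nonpos h]; ring
    · rw [max_eq_left h, max_eq_right (by linarith), abs_of_nonneg h]; ring
  rw [𝓔.energy_eq g hg, 𝓔.energy_eq _ habs, ← ENNReal.ofReal_ofNat 3,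
    ← ENNReal.ofReal_mul (by norm_num)]
  refine ENNReal.ofReal_le_ofReal ?_
  have h1 := 𝓔.form_sub_self p m
  rw [hpm] at h1
  rw [form_add_self]
  linarith

end SymmDirichletForm

/-! ### Measurable families of functions as `L²`-valued maps -/

section LpValued

variable {X : Type*} [MeasurableSpace X] {μ : Measure X} {Ω : Type*} [MeasurableSpace Ω]

lemma eLpNorm_two_eq (f : X → ℝ) : eLpNorm f 2 μ = (∫⁻ x, ‖f x‖ₑ ^ 2 ∂μ) ^ (2⁻¹ : ℝ) := by
  rw [eLpNorm_eq_lintegral_rpow_enorm_toReal (by norm_num) (by norm_num)]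
  simp

lemma memLp_two_iff {f : X → ℝ} :
    MemLp f 2 μ ↔ AEStronglyMeasurable f μ ∧ ∫⁻ x, ‖f x‖ₑ ^ 2 ∂μ < ∞ := by
  rw [MemLp, eLpNorm_two_eq, ENNReal.rpow_lt_top_iff_of_pos (by norm_num)]

open Classical in
/-- The class in `L²` of a function, and `0` if the function is not square integrable. -/
def toL2 (μ : Measure X) (f : X → ℝ) : Lp ℝ 2 μ := if h : MemLp f 2 μ then h.toLp f else 0

lemma coeFn_toL2 {f : X → ℝ} (h : MemLp f 2 μ) : toL2 μ f =ᵐ[μ] f := by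
  rw [toL2, dif_pos h]; exact h.coeFn_toLp

lemma measurableSet_memLp_two [SFinite μ] {G : Ω → X → ℝ} (hG : Measurable (Function.uncurry G)) :
    MeasurableSet {z | MemLp (G z) 2 μ} := by
  have : {z | MemLp (G z) 2 μ} = {z | ∫⁻ x, ‖G z x‖ₑ ^ 2 ∂μ < ∞} := by
    ext z
    have hz : Measurable (G z) := hG.comp measurable_prodMk_left
    simp [memLp_two_iff, hz.aestronglyMeasurable]
  rw [this]
  refine measurableSet_lt (Measurable.lintegral_prod_right' (f := fun p : Ω × X =>
    ‖G p.1 p.2‖ₑ ^ 2) ?_) measurable_const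
  exact (hG.enorm).pow_const 2

/-- The distance to any fixed class is measurable by Tonelli, and in the separable space `L²` every
open set is a countable union of balls. -/
lemma measurable_toL2 [SFinite μ] [MeasureTheory.IsSeparable μ] {G : Ω → X → ℝ}
    (hG : Measurable (Function.uncurry G)) :
    Measurable[_, borel _] fun z => toL2 μ (G z) := by
  classical
  have : Fact ((2 : ℝ≥0∞) ≠ ∞) := ⟨ENNReal.ofNat_ne_top⟩
  borelize ↥(Lp ℝ 2 μ)
  have hdist : ∀ h : Lp ℝ 2 μ, Measurable fun z => dist (toL2 μ (G z)) h := fun h => by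
    have heq : (fun z => dist (toL2 μ (G z)) h) = fun z => if z ∈ {z | MemLp (G z) 2 μ} then
        ((∫⁻ x, ‖G z x - h x‖ₑ ^ 2 ∂μ) ^ (2⁻¹ : ℝ)).toReal else dist 0 h := by
      funext z
      split_ifs with hz
      · rw [dist_eq_norm, Lp.norm_def, eLpNorm_two_eq]
        congr 2
        refine lintegral_congr_ae ?_
        filter_upwards [coeFn_toL2 hz, Lp.coeFn_sub (toL2 μ (G z)) h] with x h1 h2
        rw [h2, Pi.sub_apply, h1]
      · rw [toL2, dif_neg (show ¬ MemLp (G z) 2 μ from hz)]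
    rw [heq]
    refine Measurable.ite (measurableSet_memLp_two hG) ?_ measurable_const
    refine ((Measurable.lintegral_prod_right' (f := fun p : Ω × X =>
      ‖G p.1 p.2 - h p.2‖ₑ ^ 2) ?_).pow_const _).ennreal_toReal
    exact ((hG.sub ((Lp.stronglyMeasurable h).measurable.comp measurable_snd)).enorm).pow_const 2
  refine measurable_of_isOpen fun O hO => ?_
  have hcov : O = ⋃ p : {p : Lp ℝ 2 μ × ℝ // Metric.ball p.1 p.2 ⊆ O},
      Metric.ball p.1.1 p.1.2 := by
    refine Set.Subset.antisymm (fun x hx => ?_) (Set.iUnion_subset fun p => p.2)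
    obtain ⟨ε, hε, h⟩ := Metric.isOpen_iff.1 hO x hx
    exact Set.mem_iUnion.2 ⟨⟨(x, ε), h⟩, Metric.mem_ball_self hε⟩
  obtain ⟨T, hT, hTO⟩ := TopologicalSpace.isOpen_iUnion_countable
    (fun p : {p : Lp ℝ 2 μ × ℝ // Metric.ball p.1 p.2 ⊆ O} => Metric.ball p.1.1 p.1.2)
    fun _ => Metric.isOpen_ball
  rw [hcov, ← hTO, Set.preimage_iUnion₂]
  exact MeasurableSet.biUnion hT fun p _ => measurableSet_lt (hdist _) measurable_const

lemma integrable_toL2 [SFinite μ] [MeasureTheory.IsSeparable μ] {P : Measure Ω} [IsProbabilityMeasure P]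
    {G : Ω → X → ℝ} (hG : Measurable (Function.uncurry G))
    (hG2 : ∫⁻ z, ∫⁻ x, ‖G z x‖ₑ ^ 2 ∂μ ∂P < ∞) : Integrable (fun z => toL2 μ (G z)) P := by
  classical
  have : Fact ((2 : ℝ≥0∞) ≠ ∞) := ⟨ENNReal.ofNat_ne_top⟩
  borelize ↥(Lp ℝ 2 μ)
  have hm : StronglyMeasurable fun z => toL2 μ (G z) := (measurable_toL2 hG).stronglyMeasurable
  have hn : ∀ z, ‖toL2 μ (G z)‖ₑ ^ 2 ≤ ∫⁻ x, ‖G z x‖ₑ ^ 2 ∂μ := fun z => by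
    by_cases hz : MemLp (G z) 2 μ
    · rw [toL2, dif_pos hz, Lp.enorm_toLp, eLpNorm_two_eq, ← ENNReal.rpow_natCast,
        ← ENNReal.rpow_mul]
      norm_num
    · simp [toL2, dif_neg hz]
  have : MemLp (fun z => toL2 μ (G z)) 2 P := by
    refine ⟨hm.aestronglyMeasurable, ?_⟩
    rw [eLpNorm_eq_lintegral_rpow_enorm_toReal (by norm_num) (by norm_num),
      ENNReal.rpow_lt_top_iff_of_pos (by norm_num)]
    simpa using (lintegral_mono hn).trans_lt hG2
  exact this.integrable (by norm_num)

/-- Both sides have the same integral over every measurable set: integration over the set is an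
inner product with an indicator, which commutes with the Bochner integral, and Fubini identifies the
result. -/
lemma coeFn_integral_toL2 [IsFiniteMeasure μ] [MeasureTheory.IsSeparable μ] {P : Measure Ω}
    [IsProbabilityMeasure P] {G : Ω → X → ℝ} (hG : Measurable (Function.uncurry G))
    (hG2 : ∫⁻ z, ∫⁻ x, ‖G z x‖ₑ ^ 2 ∂μ ∂P < ∞) :
    (∫ z, toL2 μ (G z) ∂P : Lp ℝ 2 μ) =ᵐ[μ] fun x => ∫ z, G z x ∂P := by
  have hGm : MemLp (Function.uncurry G) 2 (P.prod μ) := by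
    refine memLp_two_iff.2 ⟨hG.aestronglyMeasurable, ?_⟩
    rwa [lintegral_prod _ (hG.enorm.pow_const 2).aemeasurable]
  have hGi : Integrable (Function.uncurry G) (P.prod μ) := hGm.integrable (by norm_num)
  have hint := integrable_toL2 hG hG2
  have hLp : ∀ f : Lp ℝ 2 μ, Integrable f μ := fun f => (Lp.memLp f).integrable (by norm_num)
  have hae : ∀ᵐ z ∂P, MemLp (G z) 2 μ := by
    have := ae_lt_top' (Measurable.lintegral_prod_right' (f := fun p : Ω × X =>
      ‖G p.1 p.2‖ₑ ^ 2) (hG.enorm.pow_const 2)).aemeasurable hG2.ne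
    filter_upwards [this] with z hz
    exact memLp_two_iff.2 ⟨(hG.comp measurable_prodMk_left).aestronglyMeasurable, hz⟩
  refine Integrable.ae_eq_of_forall_setIntegral_eq _ _ (hLp _) hGi.integral_prod_right ?_
  intro A hA hμA
  have h1 : ∀ f : Lp ℝ 2 μ, ∫ x in A, f x ∂μ =
      inner ℝ (indicatorConstLp 2 hA hμA.ne (1 : ℝ)) f := fun f =>
    (L2.inner_indicatorConstLp_one hA hμA.ne f).symm
  rw [h1, ← integral_inner hint]
  have hGA : Integrable (Function.uncurry G) (P.prod (μ.restrict A)) :=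
    hGi.mono_measure (Measure.prod_mono le_rfl Measure.restrict_le_self)
  rw [← integral_integral_swap hGA]
  refine integral_congr_ae ?_
  filter_upwards [hae] with z hz
  rw [← h1]
  exact integral_congr_ae (ae_restrict_of_ae (coeFn_toL2 hz))

end LpValued

/-! ### Jensen's inequality for the energy -/

namespace SymmDirichletForm

variable {X : Type*} [MeasurableSpace X] {μ : Measure X} (𝓔 : SymmDirichletForm μ)
  {Ω : Type*} [MeasurableSpace Ω]

lemma measurable_energy [SFinite μ] [MeasureTheory.IsSeparable μ] {G : Ω → X → ℝ}
    (hG : Measurable (Function.uncurry G)) :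
    Measurable fun z => 𝓔.toEnergyForm.energy (G z) := by
  classical
  have : Fact ((2 : ℝ≥0∞) ≠ ∞) := ⟨ENNReal.ofNat_ne_top⟩
  borelize ↥(Lp ℝ 2 μ)
  have heq : (fun z => 𝓔.toEnergyForm.energy (G z)) = fun z => if z ∈ {z | MemLp (G z) 2 μ} then
      𝓔.toEnergyForm.energy (toL2 μ (G z)) else ∞ := by
    funext z
    split_ifs with hz
    · exact 𝓔.energy_congr (coeFn_toL2 hz).symm
    · by_contra h
      exact hz (𝓔.memLp_of_dom (𝓔.exists_of_energy_ne_top h))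
  rw [heq]
  exact Measurable.ite (measurableSet_memLp_two hG)
    (𝓔.lowerSemicontinuous_energy.measurable.comp (measurable_toL2 hG)) measurable_const

/-- Jensen's inequality for the energy. -/
theorem energy_integral_le [IsFiniteMeasure μ] [MeasureTheory.IsSeparable μ] {P : Measure Ω}
    [IsProbabilityMeasure P] {G : Ω → X → ℝ} (hG : Measurable (Function.uncurry G))
    (hG2 : ∫⁻ z, ∫⁻ x, ‖G z x‖ₑ ^ 2 ∂μ ∂P < ∞) :
    𝓔.toEnergyForm.energy (fun x => ∫ z, G z x ∂P) ≤
      ∫⁻ z, 𝓔.toEnergyForm.energy (G z) ∂P := by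
  by_cases htop : ∫⁻ z, 𝓔.toEnergyForm.energy (G z) ∂P = ∞
  · rw [htop]; exact le_top
  have hem := 𝓔.measurable_energy hG
  have hint := integrable_toL2 hG hG2
  have ht := integrable_toReal_of_lintegral_ne_top hem.aemeasurable htop
  have hfin := ae_lt_top hem htop
  -- The pair (class, energy) lies in the epigraph for almost every parameter, hence so does its
  -- mean.
  have hmem := 𝓔.convex_epigraph.integral_mem 𝓔.isClosed_epigraph
    (f := fun z => (toL2 μ (G z), (𝓔.toEnergyForm.energy (G z)).toReal)) (μ := P)
    (by
      filter_upwards [hfin] with z hz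
      rw [← 𝓔.energy_le_iff_mem_epigraph _ _ ENNReal.toReal_nonneg, ENNReal.ofReal_toReal hz.ne,
        𝓔.energy_congr (coeFn_toL2 (𝓔.memLp_of_dom (𝓔.dom_iff_energy_lt_top.2 hz)))])
    (hint.prodMk ht)
  rw [integral_pair hint ht, ← 𝓔.energy_le_iff_mem_epigraph _ _
    (integral_nonneg fun z => ENNReal.toReal_nonneg), 𝓔.energy_congr (coeFn_integral_toL2 hG hG2),
    integral_toReal hem.aemeasurable hfin, ENNReal.ofReal_toReal htop] at hmem
  exact hmem

end SymmDirichletForm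

/-! ### Tensorization of the super Poincaré inequality -/

section Marginal

variable {ι : Type*} [DecidableEq ι] [Fintype ι] {X : ι → Type*} [∀ i, MeasurableSpace (X i)]
  {μ : ∀ i, Measure (X i)} [∀ i, IsProbabilityMeasure (μ i)]

lemma lintegral_lmarginal (s : Finset ι) {f : (∀ i, X i) → ℝ≥0∞} (hf : Measurable f) :
    ∫⁻ x, (∫⋯∫⁻_s, f ∂μ) x ∂Measure.pi μ = ∫⁻ x, f x ∂Measure.pi μ := by
  refine lintegral_eq_of_lmarginal_eq s (hf.lmarginal μ) hf ?_
  funext x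
  have : ∀ y, (∫⋯∫⁻_s, f ∂μ) (Function.updateFinset x s y) = (∫⋯∫⁻_s, f ∂μ) x := fun y =>
    lmarginal_congr μ f fun i hi => by simp [Function.updateFinset, hi]
  rw [lmarginal]
  simp [this]

end Marginal

namespace SymmDirichletForm

variable {X : Type*} [MeasurableSpace X] {μ : Measure X} (𝓔 : SymmDirichletForm μ)
  {Ω : Type*} [MeasurableSpace Ω]

/-- Integrating out a parameter in a super Poincaré inequality. -/
lemma lintegral_sq_lintegral_le [IsFiniteMeasure μ] [MeasureTheory.IsSeparable μ] {P : Measure Ω}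
    [IsProbabilityMeasure P] {t b : ℝ≥0∞}
    (h : ∀ f : X → ℝ, ∫⁻ x, ‖f x‖ₑ ^ 2 ∂μ ≤
      t * 𝓔.toEnergyForm.energy f + b * (∫⁻ x, ‖f x‖ₑ ∂μ) ^ 2)
    {G : Ω → X → ℝ} (hG : Measurable (Function.uncurry G))
    (hG2 : ∫⁻ z, ∫⁻ x, ‖G z x‖ₑ ^ 2 ∂μ ∂P < ∞) :
    ∫⁻ x, (∫⁻ z, ‖G z x‖ₑ ∂P) ^ 2 ∂μ ≤
      t * (3 * ∫⁻ z, 𝓔.toEnergyForm.energy (G z) ∂P) + b * (∫⁻ x, ∫⁻ z, ‖G z x‖ₑ ∂P ∂μ) ^ 2 := by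
  have hGm : MemLp (Function.uncurry G) 2 (P.prod μ) := by
    refine memLp_two_iff.2 ⟨hG.aestronglyMeasurable, ?_⟩
    rwa [lintegral_prod _ (hG.enorm.pow_const 2).aemeasurable]
  have hGi : Integrable (Function.uncurry G) (P.prod μ) := hGm.integrable (by norm_num)
  have hae : ∀ᵐ x ∂μ, ‖∫ z, |G z x| ∂P‖ₑ = ∫⁻ z, ‖G z x‖ₑ ∂P := by
    filter_upwards [hGi.prod_left_ae] with x hx
    rw [← ofReal_integral_norm_eq_lintegral_enorm (f := fun z => G z x) hx,
      Real.enorm_of_nonneg (integral_nonneg fun z => abs_nonneg _)]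
    rfl
  have h1 := h fun x => ∫ z, |G z x| ∂P
  rw [lintegral_congr_ae hae,
    lintegral_congr_ae (hae.mono fun x hx => show _ = (∫⁻ z, ‖G z x‖ₑ ∂P) ^ 2 by rw [hx])] at h1
  refine h1.trans ?_
  gcongr
  refine (𝓔.energy_integral_le (G := fun z x => |G z x|) hG.abs (by simpa using hG2)).trans ?_
  refine (lintegral_mono fun z => 𝓔.energy_abs_le (G z)).trans_eq ?_
  rw [lintegral_const_mul _ (𝓔.measurable_energy hG)]

variable {ι : Type*} [DecidableEq ι] [Fintype ι]

/-- Tensorization of the super Poincaré inequality, one coordinate. -/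
lemma lintegral_lmarginal_sq_le [IsProbabilityMeasure μ] [MeasureTheory.IsSeparable μ] {t b : ℝ≥0∞}
    (h : ∀ f : X → ℝ, ∫⁻ x, ‖f x‖ₑ ^ 2 ∂μ ≤
      t * 𝓔.toEnergyForm.energy f + b * (∫⁻ x, ‖f x‖ₑ ∂μ) ^ 2)
    {s : Finset ι} {i : ι} (hi : i ∉ s) {f : (ι → X) → ℝ} (hf : Measurable f)
    (hf2 : ∫⁻ x, ‖f x‖ₑ ^ 2 ∂Measure.pi (fun _ => μ) < ∞) :
    ∫⁻ x, (∫⋯∫⁻_s, (fun x => ‖f x‖ₑ) ∂fun _ => μ) x ^ 2 ∂Measure.pi (fun _ => μ) ≤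
      t * (3 * ∫⁻ x, 𝓔.toEnergyForm.energy (fun y => f (Function.update x i y))
        ∂Measure.pi (fun _ => μ)) +
      b * ∫⁻ x, (∫⋯∫⁻_insert i s, (fun x => ‖f x‖ₑ) ∂fun _ => μ) x ^ 2
        ∂Measure.pi (fun _ => μ) := by
  have hupd : Measurable fun p : (ι → X) × X => Function.update p.1 i p.2 := by fun_prop
  set e : (ι → X) → ℝ≥0∞ := fun x => 𝓔.toEnergyForm.energy (fun y => f (Function.update x i y))
    with he
  have hem : Measurable e := 𝓔.measurable_energy (hf.comp hupd)
  set M := ∫⋯∫⁻_s, (fun x => ‖f x‖ₑ) ∂fun _ => μ with hM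
  have hMm : Measurable M := hf.enorm.lmarginal _
  have hMsq : Measurable fun x => M x ^ 2 := hMm.pow_const 2
  -- Since `i ∉ s`, changing coordinate `i` commutes with integrating out `s`: in that coordinate
  -- `M` is an average of slices of `|f|`.
  have hMu : ∀ x y, M (Function.update x i y) =
      ∫⁻ z, ‖f (Function.update (Function.updateFinset x s z) i y)‖ₑ ∂Measure.pi fun _ => μ :=
    fun x y => lmarginal_update_of_notMem hf.enorm hi x y
  have hfin : ∀ᵐ x ∂Measure.pi (fun _ : ι => μ),
      (∫⋯∫⁻_insert i s, (fun x => ‖f x‖ₑ ^ 2) ∂fun _ => μ) x < ∞ := by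
    refine ae_lt_top ((hf.enorm.pow_const 2).lmarginal _) ?_
    rw [lintegral_lmarginal _ (hf.enorm.pow_const 2)]
    exact hf2.ne
  have hpt : ∀ᵐ x ∂Measure.pi (fun _ : ι => μ), (∫⋯∫⁻_{i}, (fun x => M x ^ 2) ∂fun _ => μ) x ≤
      t * (3 * (∫⋯∫⁻_s, e ∂fun _ => μ) x) +
        b * (∫⋯∫⁻_insert i s, (fun x => ‖f x‖ₑ) ∂fun _ => μ) x ^ 2 := by
    filter_upwards [hfin] with x hx
    rw [lmarginal_insert' _ (hf.enorm.pow_const 2) hi] at hx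
    rw [lmarginal_insert _ hf.enorm hi, lmarginal_singleton]
    simp only [← hM, hMu]
    refine 𝓔.lintegral_sq_lintegral_le h
      (G := fun z y => f (Function.update (Function.updateFinset x s z) i y)) ?_ hx
    exact hf.comp (hupd.comp ((measurable_updateFinset.comp measurable_fst).prodMk measurable_snd))
  calc _ = ∫⁻ x, (∫⋯∫⁻_{i}, (fun x => M x ^ 2) ∂fun _ => μ) x ∂Measure.pi (fun _ => μ) :=
        (lintegral_lmarginal _ hMsq).symm
    _ ≤ _ := lintegral_mono_ae hpt
    _ = _ := by
        have h1 : Measurable (∫⋯∫⁻_s, e ∂fun _ => μ) := hem.lmarginal _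
        have h2 : Measurable (∫⋯∫⁻_insert i s, (fun x => ‖f x‖ₑ) ∂fun _ => μ) :=
          hf.enorm.lmarginal _
        rw [lintegral_add_left ((h1.const_mul _).const_mul _), lintegral_const_mul _ (h1.const_mul _),
          lintegral_const_mul _ h1, lintegral_const_mul _ (h2.pow_const 2),
          lintegral_lmarginal _ hem]

/-- Tensorization of the super Poincaré inequality. -/
theorem exists_lintegral_sq_le_pi [IsProbabilityMeasure μ] [MeasureTheory.IsSeparable μ]
    (h : ∀ t : ℝ≥0, 0 < t → ∃ b : ℝ≥0, ∀ f : X → ℝ, ∫⁻ x, ‖f x‖ₑ ^ 2 ∂μ ≤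
      t * 𝓔.toEnergyForm.energy f + b * (∫⁻ x, ‖f x‖ₑ ∂μ) ^ 2)
    (s : Finset ι) (r : ℝ≥0) (hr : 0 < r) : ∃ B : ℝ≥0, ∀ f : (ι → X) → ℝ, Measurable f →
      ∫⁻ x, ‖f x‖ₑ ^ 2 ∂Measure.pi (fun _ => μ) < ∞ →
      ∫⁻ x, ‖f x‖ₑ ^ 2 ∂Measure.pi (fun _ => μ) ≤
        r * ∑ i ∈ s, ∫⁻ x, 𝓔.toEnergyForm.energy (fun y => f (Function.update x i y))
          ∂Measure.pi (fun _ => μ) +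
        B * ∫⁻ x, (∫⋯∫⁻_s, (fun x => ‖f x‖ₑ) ∂fun _ => μ) x ^ 2 ∂Measure.pi (fun _ => μ) := by
  induction s using Finset.induction_on with
  | empty => exact ⟨1, fun f _ _ => by simp⟩
  | insert i s hi ih =>
    obtain ⟨B, hB⟩ := ih
    -- The parameter is chosen so that `B` times it times the factor 3 lost in passing to `|f|` is
    -- at most `r`; the `+ 1` covers `B = 0`.
    obtain ⟨b, hb⟩ := h (r / (3 * (B + 1))) (by positivity)
    refine ⟨B * b, fun f hf hf2 => ?_⟩
    have hc : (B : ℝ≥0∞) * ((r / (3 * (B + 1)) : ℝ≥0) * 3) ≤ r := by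
      norm_cast
      have : B * (r / (3 * (B + 1)) * 3) = r * (B / (B + 1)) := by field_simp
      rw [this]
      exact mul_le_of_le_one_right' (div_le_one_of_le₀ (by simp) (by simp))
    have hcalc : ∀ {a S A A' e : ℝ≥0∞}, a ≤ r * S + B * A →
        A ≤ (r / (3 * (B + 1)) : ℝ≥0) * (3 * e) + b * A' → a ≤ r * (e + S) + (B * b : ℝ≥0) * A' :=
      fun {a S A A' e} h1 h2 => calc
        a ≤ r * S + B * ((r / (3 * (B + 1)) : ℝ≥0) * (3 * e) + b * A') := h1.trans (by gcongr)
        _ = r * S + (B * ((r / (3 * (B + 1)) : ℝ≥0) * 3)) * e + (B * b : ℝ≥0) * A' := by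
          rw [ENNReal.coe_mul]; ring
        _ ≤ r * S + r * e + (B * b : ℝ≥0) * A' := by gcongr
        _ = _ := by ring
    rw [Finset.sum_insert hi]
    exact hcalc (hB f hf hf2) (𝓔.lintegral_lmarginal_sq_le hb hi hf hf2)

end SymmDirichletForm

/-! ### Super Poincaré inequalities in extended nonnegative numbers -/

lemma lintegral_enorm_sq_eq {X : Type*} [MeasurableSpace X] {μ : Measure X} {f : X → ℝ}
    (hf : MemLp f 2 μ) : ∫⁻ x, ‖f x‖ₑ ^ 2 ∂μ = ENNReal.ofReal (∫ x, f x ^ 2 ∂μ) := by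
  rw [ofReal_integral_eq_lintegral_ofReal hf.integrable_sq (ae_of_all _ fun x => sq_nonneg _)]
  refine lintegral_congr fun x => ?_
  rw [Real.enorm_eq_ofReal_abs, ← ENNReal.ofReal_pow (abs_nonneg _), sq_abs]

lemma lintegral_enorm_eq {X : Type*} [MeasurableSpace X] {μ : Measure X} {f : X → ℝ}
    (hf : Integrable f μ) : ∫⁻ x, ‖f x‖ₑ ∂μ = ENNReal.ofReal (∫ x, |f x| ∂μ) :=
  (ofReal_integral_norm_eq_lintegral_enorm hf).symm

/-- In this form sums and integrals can be handled without integrability side conditions. The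
constant `b` may vanish; adding 1 makes `β` positive again. -/
lemma superPoincare_iff {X : Type*} [MeasurableSpace X] {μ : Measure X} [IsFiniteMeasure μ]
    {𝓔 : EnergyForm X} (hmem : ∀ f, 𝓔.dom f → MemLp f 2 μ)
    (hfin : ∀ f, 𝓔.dom f → 𝓔.energy f < ∞) :
    SuperPoincare μ 𝓔 ↔ ∀ t : ℝ≥0, 0 < t → ∃ b : ℝ≥0, ∀ f, 𝓔.dom f →
      ∫⁻ x, ‖f x‖ₑ ^ 2 ∂μ ≤ t * 𝓔.energy f + b * (∫⁻ x, ‖f x‖ₑ ∂μ) ^ 2 := by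
  have key : ∀ (t b : ℝ≥0) f, 𝓔.dom f →
      (∫⁻ x, ‖f x‖ₑ ^ 2 ∂μ ≤ t * 𝓔.energy f + b * (∫⁻ x, ‖f x‖ₑ ∂μ) ^ 2 ↔
        ∫ x, f x ^ 2 ∂μ ≤ t * (𝓔.energy f).toReal + b * (∫ x, |f x| ∂μ) ^ 2) := fun t b f hf => by
    have h0 : 0 ≤ ∫ x, |f x| ∂μ := integral_nonneg fun x => abs_nonneg _
    rw [lintegral_enorm_sq_eq (hmem f hf),
      lintegral_enorm_eq ((hmem f hf).integrable (by norm_num)),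
      ← ENNReal.ofReal_toReal (hfin f hf).ne, ← ENNReal.ofReal_coe_nnreal,
      ← ENNReal.ofReal_coe_nnreal (p := b), ← ENNReal.ofReal_pow h0,
      ← ENNReal.ofReal_mul t.coe_nonneg, ← ENNReal.ofReal_mul b.coe_nonneg,
      ← ENNReal.ofReal_add (by positivity) (by positivity),
      ENNReal.ofReal_le_ofReal_iff (by positivity), ENNReal.toReal_ofReal ENNReal.toReal_nonneg]
  constructor
  · rintro ⟨β, hβ, h⟩ t ht
    refine ⟨⟨β t, (hβ t ht).le⟩, fun f hf => (key _ _ f hf).2 (h t ht f hf)⟩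
  · intro h
    choose! b hb using h
    refine ⟨fun r => b r.toNNReal + 1, fun r _ => by positivity, fun r hr f hf => ?_⟩
    have h1 := (key _ _ f hf).1 (hb r.toNNReal (Real.toNNReal_pos.2 hr) f hf)
    rw [Real.coe_toNNReal r hr.le] at h1
    refine h1.trans ?_
    gcongr
    linarith

lemma lintegral_natLaw (ϱ : ℕ → ℝ) (g : ℕ → ℝ≥0∞) :
    ∫⁻ n, g n ∂natLaw ϱ = ∑' n, ENNReal.ofReal (ϱ n) * g n := by
  rw [natLaw, lintegral_sum_measure]
  simp [lintegral_smul_measure]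

lemma isProbabilityMeasure_natLaw {ϱ : ℕ → ℝ} (h0 : ∀ i, 0 < ϱ i) (h1 : HasSum ϱ 1) :
    IsProbabilityMeasure (natLaw ϱ) := by
  constructor
  have := lintegral_natLaw ϱ fun _ => 1
  rw [lintegral_one] at this
  rw [this]
  simp only [mul_one]
  rw [← ENNReal.ofReal_tsum_of_nonneg (fun n => (h0 n).le) h1.summable, h1.tsum_eq,
    ENNReal.ofReal_one]

/-! ### Measurability and integration on configurations -/

section Configurations

variable {E : Type*} [MeasurableSpace E]

lemma addParticles_conf {n k : ℕ} (y : Fin n → E) (x : Fin k → E) :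
    (conf y).addParticles x = conf (Fin.append y x) := by
  refine Subtype.ext (Subtype.ext ?_)
  change (∑ i, Measure.dirac (y i)) + (∑ i, Measure.dirac (x i)) =
      ∑ i, Measure.dirac (Fin.append y x i)
  rw [Fin.sum_univ_add]
  simp

/-- The number of particles of a configuration. -/
def FinConf.card (γ : FinConf E) : ℕ := ⌊γ.toFiniteMeasure.mass⌋₊

lemma card_conf {n : ℕ} (x : Fin n → E) : (conf x).card = n := by
  have : (conf x).toFiniteMeasure.mass = n := by
    rw [← ENNReal.coe_inj, FiniteMeasure.ennreal_mass]
    change (∑ i, Measure.dirac (x i)) Set.univ = _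
    simp
  rw [FinConf.card, this, Nat.floor_natCast]

variable [TopologicalSpace E]

lemma measurable_card [OpensMeasurableSpace E] : Measurable (FinConf.card : FinConf E → ℕ) := by
  have : Continuous fun γ : FinConf E => γ.toFiniteMeasure.mass :=
    FiniteMeasure.continuous_mass.comp continuous_induced_dom
  exact Nat.measurable_floor.comp this.measurable

variable [BorelSpace E]

lemma measurable_conf [SecondCountableTopology E] {n : ℕ} :
    Measurable (conf : (Fin n → E) → FinConf E) := by
  refine Continuous.measurable (continuous_induced_rng.2 ?_)
  refine FiniteMeasure.continuous_iff_forall_continuous_lintegral.2 fun f => ?_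
  have : ∀ x : Fin n → E, ∫⁻ y, f y ∂((FinConf.toFiniteMeasure ∘ conf) x : Measure E) =
      ∑ i, (f (x i) : ℝ≥0∞) := fun x => by
    change ∫⁻ y, f y ∂(∑ i, Measure.dirac (x i)) = _
    rw [lintegral_finsetSum_measure]
    refine Finset.sum_congr rfl fun i _ => ?_
    exact lintegral_dirac' _ (f.continuous.measurable.coe_nnreal_ennreal)
  simp only [this]
  fun_prop

/-- Closed sets are a generating π-system, and the mass of a closed set is a limit of integrals of
bounded continuous functions, each weakly continuous in `γ`. -/
lemma measurable_coe_measure [HasOuterApproxClosed E] :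
    Measurable fun γ : FinConf E => (γ.toFiniteMeasure : Measure E) := by
  have hint : ∀ f : BoundedContinuousFunction E ℝ≥0,
      Measurable fun γ : FinConf E => ∫⁻ x, f x ∂(γ.toFiniteMeasure : Measure E) := fun f =>
    ((FiniteMeasure.continuous_lintegral_boundedContinuousFunction f).comp
      continuous_induced_dom).measurable
  refine Measurable.measure_of_isPiSystem (S := {s | IsClosed s})
    (by rw [BorelSpace.measurable_eq (α := E), borel_eq_generateFrom_isClosed])
    isPiSystem_isClosed (fun s hs => ?_) ?_
  · exact measurable_of_tendsto_metrizable (f := fun (n : ℕ) (γ : FinConf E) =>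
      ∫⁻ x, IsClosed.apprSeq hs n x ∂(γ.toFiniteMeasure : Measure E)) (fun n => hint _)
      (tendsto_pi_nhds.2 fun γ => HasOuterApproxClosed.tendsto_lintegral_apprSeq hs _)
  · simpa using hint 1

variable {ϱ : ℕ → ℝ} {μ : ∀ n : ℕ, Measure (Fin n → E)}

lemma ae_conf [SecondCountableTopology E] {p : FinConf E → Prop} (h : ∀ᵐ γ ∂confLaw ϱ μ, p γ)
    {n : ℕ} (hn : 0 < ϱ n) : ∀ᵐ x ∂μ n, p (conf x) := by
  refine ae_of_ae_map measurable_conf.aemeasurable ?_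
  refine Measure.AbsolutelyContinuous.ae_le ?_ h
  exact (Measure.absolutelyContinuous_smul (by simpa using hn)).trans
    (Measure.absolutelyContinuous_sum_right n (Measure.AbsolutelyContinuous.refl _))

lemma lintegral_confLaw [SecondCountableTopology E] {g : FinConf E → ℝ≥0∞}
    (hg : AEMeasurable g (confLaw ϱ μ)) (h0 : ∀ i, 0 < ϱ i) :
    ∫⁻ γ, g γ ∂confLaw ϱ μ = ∑' n, ENNReal.ofReal (ϱ n) * ∫⁻ x, g (conf x) ∂μ n := by
  obtain ⟨g', hg', hae⟩ := hg
  rw [lintegral_congr_ae hae]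
  have : ∀ n, ∫⁻ x, g (conf x) ∂μ n = ∫⁻ x, g' (conf x) ∂μ n := fun n =>
    lintegral_congr_ae (ae_conf hae (h0 n))
  simp only [this]
  rw [confLaw, lintegral_sum_measure]
  simp only [lintegral_smul_measure, smul_eq_mul]
  congr with n
  rw [lintegral_map hg' measurable_conf]

lemma isProbabilityMeasure_confLaw [SecondCountableTopology E] [∀ n, IsProbabilityMeasure (μ n)]
    (h0 : ∀ i, 0 < ϱ i) (h1 : HasSum ϱ 1) : IsProbabilityMeasure (confLaw ϱ μ) := by
  constructor
  have := lintegral_confLaw (ϱ := ϱ) (μ := μ) (g := fun _ => 1) aemeasurable_const h0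
  rw [lintegral_one] at this
  rw [this]
  simp only [lintegral_one, measure_univ, mul_one]
  rw [← ENNReal.ofReal_tsum_of_nonneg (fun n => (h0 n).le) h1.summable, h1.tsum_eq,
    ENNReal.ofReal_one]

end Configurations

section

lemma superPoincare_chainForm_iff (hϱ_pos : ∀ i, 0 < ϱ i) (hϱ_sum : HasSum ϱ 1) :
    SuperPoincare (natLaw ϱ) (chainForm q ϱ) ↔
      ∀ t : ℝ≥0, 0 < t → ∃ b : ℝ≥0, ∀ r, (chainForm q ϱ).dom r →
        ∫⁻ n, ‖r n‖ₑ ^ 2 ∂natLaw ϱ ≤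
          t * chainEnergy q ϱ r + b * (∫⁻ n, ‖r n‖ₑ ∂natLaw ϱ) ^ 2 :=
  haveI := isProbabilityMeasure_natLaw hϱ_pos hϱ_sum
  superPoincare_iff (fun _ hf => hf.1) fun _ hf => hf.2

lemma coordSlice_eval_zero {E : Type*} (f : E → ℝ) (x : ℕ → E) (i : ℕ) :
    coordSlice (fun x => f (x 0)) x i = if i = 0 then f else fun _ => f (x 0) := by
  funext y
  split_ifs with h
  · subst h; simp [coordSlice]
  · simp [coordSlice, Function.update_of_ne (Ne.symm h)]

lemma ofReal_sq (a : ℝ) : ENNReal.ofReal (a ^ 2) = ‖a‖ₑ ^ 2 := by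
  rw [Real.enorm_eq_ofReal_abs, ← ENNReal.ofReal_pow (abs_nonneg _), sq_abs]

/-- The term `s * C * A` is at most half of the left side; moving it over and dividing by `p`
doubles the other constants. -/
lemma absorb_le {p C s t b : ℝ≥0} (hp : 0 < p) (hC : s * C ≤ p / 2) (hst : 2 * s ≤ t) (ht : 0 < t)
    {A a e : ℝ≥0∞} (hA : A ≠ ∞) (ha : a ≠ ∞) (h : p * A ≤ s * (p * e + C * A) + b * (p * a) ^ 2) :
    A ≤ t * e + (2 * b * p : ℝ≥0) * a ^ 2 := by
  rcases eq_or_ne e ∞ with rfl | he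
  · rw [ENNReal.mul_top (by exact_mod_cast ht.ne')]; simp
  lift A to ℝ≥0 using hA
  lift a to ℝ≥0 using ha
  lift e to ℝ≥0 using he
  norm_cast at h ⊢
  rw [← NNReal.coe_le_coe] at *
  push_cast at *
  have hp' : (0 : ℝ) < p := hp
  refine le_of_mul_le_mul_left ?_ hp'
  have h1 := mul_le_mul_of_nonneg_right hC A.coe_nonneg
  have h2 := mul_le_mul_of_nonneg_right hst (mul_nonneg hp'.le e.coe_nonneg)
  nlinarith

end

/-! ### Constants and one-particle functions in the product forms -/

section PowerForm

variable {E : Type*} [MeasurableSpace E] {ν : Measure E} [IsProbabilityMeasure ν]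

instance (n : ℕ) : IsProbabilityMeasure (powerLaw ν n) := by
  unfold powerLaw; infer_instance

instance : IsProbabilityMeasure (infLaw ν) := by
  unfold infLaw; infer_instance

variable {𝓔 : SymmDirichletForm ν}

lemma superPoincare_toEnergyForm_iff :
    SuperPoincare ν 𝓔.toEnergyForm ↔ ∀ t : ℝ≥0, 0 < t → ∃ b : ℝ≥0, ∀ f : E → ℝ,
      ∫⁻ x, ‖f x‖ₑ ^ 2 ∂ν ≤ t * 𝓔.toEnergyForm.energy f + b * (∫⁻ x, ‖f x‖ₑ ∂ν) ^ 2 := by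
  rw [superPoincare_iff (fun _ hf => 𝓔.memLp_of_dom hf) fun _ hf => 𝓔.dom_iff_energy_lt_top.1 hf]
  refine forall₂_congr fun t ht => exists_congr fun b => forall_congr' fun f => ?_
  refine ⟨fun h => ?_, fun h _ => h⟩
  by_cases hf : 𝓔.toEnergyForm.energy f = ∞
  · rw [hf, ENNReal.mul_top (by exact_mod_cast ht.ne')]; simp
  · exact h (𝓔.exists_of_energy_ne_top hf)

lemma powerForm_energy_const (h : 𝓔.Conservative) (n : ℕ) (c : ℝ) :
    (powerForm 𝓔 n).energy (fun _ => c) = 0 := by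
  change infEnergy 𝓔 (fun _ => c) = 0
  have : ∀ (x : ℕ → E) i, coordSlice (fun _ => c) x i = fun _ => c := fun x i => rfl
  simp [infEnergy, this, 𝓔.energy_const h]

lemma powerForm_dom_const (h : 𝓔.Conservative) (n : ℕ) (c : ℝ) :
    (powerForm 𝓔 n).dom (fun _ => c) := by
  refine ⟨memLp_const c, memLp_const c, fun i => ae_of_all _ fun x => ?_, ?_⟩
  · rw [𝓔.dom_iff_energy_lt_top]
    exact (𝓔.energy_const h c).trans_lt ENNReal.zero_lt_top
  · exact (powerForm_energy_const h n c).trans_lt ENNReal.zero_lt_top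

lemma powerForm_energy_one (h : 𝓔.Conservative) (f : E → ℝ) :
    (powerForm 𝓔 1).energy (fun x => f (x 0)) = 𝓔.toEnergyForm.energy f := by
  change infEnergy 𝓔 (fun x => f (x 0)) = _
  rw [infEnergy, tsum_eq_single 0]
  · simp [coordSlice_eval_zero]
  · intro i hi
    simp [coordSlice_eval_zero, hi, 𝓔.energy_const h]

lemma powerForm_dom_one (h : 𝓔.Conservative) {f : E → ℝ} (hf : 𝓔.toEnergyForm.dom f) :
    (powerForm 𝓔 1).dom (fun x => f (x 0)) := by
  have hm := 𝓔.memLp_of_dom hf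
  refine ⟨hm.comp_measurePreserving (measurePreserving_eval (fun _ : Fin 1 => ν) 0),
    hm.comp_measurePreserving (measurePreserving_eval_infinitePi (fun _ : ℕ => ν) 0),
    fun i => ae_of_all _ fun x => ?_, ?_⟩
  · change 𝓔.toEnergyForm.dom (coordSlice (fun x => f (x 0)) x i)
    rw [coordSlice_eval_zero]
    split_ifs
    · exact hf
    · rw [𝓔.dom_iff_energy_lt_top, 𝓔.energy_const h]
      exact ENNReal.zero_lt_top
  · exact (powerForm_energy_one h f).trans_lt (𝓔.dom_iff_energy_lt_top.1 hf)

lemma measurable_append {E : Type*} [MeasurableSpace E] (n k : ℕ) :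
    Measurable fun p : (Fin n → E) × (Fin k → E) => Fin.append p.1 p.2 := by
  refine measurable_pi_iff.2 fun i => ?_
  refine Fin.addCases (fun i => ?_) (fun i => ?_) i
  · simp only [Fin.append_left]; fun_prop
  · simp only [Fin.append_right]; fun_prop

lemma lintegral_birth {κ : ∀ n k : ℕ, Kernel (Fin n → E) (Fin k → E)}
    (hκ : IsBirthKernel (powerLaw ν) κ) [∀ n k, IsMarkovKernel (κ n k)]
    (n k : ℕ) {g : (Fin (n + k) → E) → ℝ≥0∞} (hg : Measurable g) :
    ∫⁻ y, ∫⁻ x, g (Fin.append y x) ∂κ n k y ∂powerLaw ν n = ∫⁻ z, g z ∂powerLaw ν (n + k) := by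
  rw [← hκ.disintegration n k, lintegral_map hg (measurable_append n k), Measure.lintegral_compProd
    (f := fun p => g (Fin.append p.1 p.2)) (hg.comp (measurable_append n k))]

end PowerForm

/-! ### The one-particle test function -/

section OneParticle

variable {E : Type*} [MeasurableSpace E]

/-- The function on configurations which is `f(x)` at `δₓ` and vanishes if the number of particles
is not one. -/
def oneParticle (f : E → ℝ) (γ : FinConf E) : ℝ :=
  if γ.card = 1 then (∫⁻ x, ENNReal.ofReal (f x) ∂(γ.toFiniteMeasure : Measure E)).toReal -
    (∫⁻ x, ENNReal.ofReal (-f x) ∂(γ.toFiniteMeasure : Measure E)).toReal else 0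

lemma oneParticle_conf_one {f : E → ℝ} (hf : Measurable f) (x : Fin 1 → E) :
    oneParticle f (conf x) = f (x 0) := by
  have h : ((conf x).toFiniteMeasure : Measure E) = Measure.dirac (x 0) := by
    change (∑ i, Measure.dirac (x i)) = _
    simp
  rw [oneParticle, if_pos (card_conf x), h, lintegral_dirac' _ hf.ennreal_ofReal,
    lintegral_dirac' _ (f := fun a => ENNReal.ofReal (-f a)) hf.neg.ennreal_ofReal, ENNReal.toReal_ofReal', ENNReal.toReal_ofReal']
  exact max_zero_sub_max_neg_zero_eq_self _

lemma oneParticle_conf_of_ne (f : E → ℝ) {n : ℕ} (hn : n ≠ 1) (x : Fin n → E) :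
    oneParticle f (conf x) = 0 := by
  rw [oneParticle, if_neg (by rwa [card_conf])]

variable {ν : Measure E} [IsProbabilityMeasure ν]

/-- Only the jump from 0 to 1 and the jumps from 1 upwards change the function, and each has squared
increment `f²` at a particle distributed according to `ν`. -/
lemma reactionEnergy_oneParticle_le {q : ℕ → ℕ → ℝ} {ϱ : ℕ → ℝ}
    {κ : ∀ n k : ℕ, Kernel (Fin n → E) (Fin k → E)} (hκ : IsBirthKernel (powerLaw ν) κ)
    [∀ n k, IsMarkovKernel (κ n k)] {f : E → ℝ} (hf : Measurable f) :
    reactionEnergy q ϱ (powerLaw ν) κ (oneParticle f) ≤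
      (ENNReal.ofReal (ϱ 0 * q 0 1) + ∑' k : ℕ, ENNReal.ofReal (ϱ 1 * q 1 (1 + (k + 1)))) *
        ∫⁻ x, ‖f x‖ₑ ^ 2 ∂ν := by
  have hev : ∀ n, ∀ i : Fin n, ∫⁻ x, ‖f (x i)‖ₑ ^ 2 ∂powerLaw ν n = ∫⁻ x, ‖f x‖ₑ ^ 2 ∂ν :=
    fun n i => (measurePreserving_eval (fun _ : Fin n => ν) i).lintegral_comp
      (hf.enorm.pow_const 2)
  simp only [reactionEnergy, addParticles_conf]
  have hsplit : ∀ T : ℕ → ℕ → ℝ≥0∞, ∑' n, ∑' k, T n k =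
      ∑' k, T 0 k + ∑' k, T (0 + 1) k + ∑' n, ∑' k, T (n + 1 + 1) k := fun T => by
    rw [tsum_eq_zero_add' (f := fun n => ∑' k, T n k) ENNReal.summable,
      tsum_eq_zero_add' (f := fun n => ∑' k, T (n + 1) k) ENNReal.summable, add_assoc]
  rw [hsplit, add_mul]
  have h2 : ∑' n : ℕ, ∑' k : ℕ, ENNReal.ofReal (ϱ (n + 1 + 1) * q (n + 1 + 1) (n + 1 + 1 + (k + 1))) *
      ∫⁻ y, ∫⁻ x, ENNReal.ofReal ((oneParticle f (conf (Fin.append y x)) -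
        oneParticle f (conf y)) ^ 2) ∂κ (n + 1 + 1) (k + 1) y ∂powerLaw ν (n + 1 + 1) = 0 := by
    refine ENNReal.tsum_eq_zero.2 fun n => ENNReal.tsum_eq_zero.2 fun k => ?_
    have h3 : n + 1 + 1 + (k + 1) ≠ 1 := by omega
    have h4 : n + 1 + 1 ≠ 1 := by omega
    simp [oneParticle_conf_of_ne f h3, oneParticle_conf_of_ne f h4]
  rw [h2, add_zero]
  refine add_le_add ?_ ?_
  · rw [tsum_eq_single 0]
    · gcongr
      have h3 : ∀ (y : Fin 0 → E) (x : Fin (0 + 1) → E),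
          ENNReal.ofReal ((oneParticle f (conf (Fin.append y x)) - oneParticle f (conf y)) ^ 2) =
            ‖f (Fin.append y x 0)‖ₑ ^ 2 := fun y x => by
        rw [ofReal_sq, oneParticle_conf_of_ne f zero_ne_one y, sub_zero]
        rw [show oneParticle f (conf (Fin.append y x)) = f (Fin.append y x 0) from
          oneParticle_conf_one hf _]
      simp only [h3]
      rw [lintegral_birth hκ 0 (0 + 1) (g := fun z => ‖f (z 0)‖ₑ ^ 2)
        ((hf.comp (measurable_pi_apply _)).enorm.pow_const 2)]
      exact (hev _ 0).le
    · intro k hk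
      have : 0 + (k + 1) ≠ 1 := by omega
      simp [oneParticle_conf_of_ne _ this, oneParticle_conf_of_ne f zero_ne_one]
  · rw [← ENNReal.tsum_mul_right]
    refine ENNReal.tsum_le_tsum fun k => ?_
    refine mul_le_mul_right ?_ _
    have h1 : 0 + 1 + (k + 1) ≠ 1 := by omega
    have h3 : ∀ (y : Fin (0 + 1) → E) (x : Fin (k + 1) → E),
          ENNReal.ofReal ((oneParticle f (conf (Fin.append y x)) - oneParticle f (conf y)) ^ 2) =
            ‖f (y 0)‖ₑ ^ 2 := fun y x => by
        rw [ofReal_sq, oneParticle_conf_of_ne f h1, zero_sub, enorm_neg]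
        rw [show oneParticle f (conf y) = f (y 0) from oneParticle_conf_one hf _]
    simp only [h3, lintegral_const, measure_univ, mul_one]
    exact (hev _ 0).le

end OneParticle

section ParticleForm

variable {E : Type*} [TopologicalSpace E] [MeasurableSpace E] [OpensMeasurableSpace E]
  {q : ℕ → ℕ → ℝ} {ϱ : ℕ → ℝ} {ν : Measure E} [IsProbabilityMeasure ν]
  {κ : ∀ n k : ℕ, Kernel (Fin n → E) (Fin k → E)} {𝓔 : SymmDirichletForm ν}

/-- The form of the particle system. -/
abbrev particleForm (q : ℕ → ℕ → ℝ) (ϱ : ℕ → ℝ) (κ : ∀ n k : ℕ, Kernel (Fin n → E) (Fin k → E))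
    (𝓔 : SymmDirichletForm ν) : EnergyForm (FinConf E) :=
  (diffusionForm ϱ (powerLaw ν) (powerForm 𝓔)).sum (reactionForm q ϱ (powerLaw ν) κ)

lemma energy_particleForm_lt_top {F : FinConf E → ℝ} (h : (particleForm q ϱ κ 𝓔).dom F) :
    (particleForm q ϱ κ 𝓔).energy F < ∞ :=
  ENNReal.add_lt_top.2 ⟨h.1.2.2, h.2.2⟩

end ParticleForm

/-! ### Necessity of the two inequalities -/

section Necessity

variable {E : Type*} [TopologicalSpace E] [PolishSpace E] [MeasurableSpace E] [BorelSpace E]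
  {q : ℕ → ℕ → ℝ} {ϱ : ℕ → ℝ} {ν : Measure E} [IsProbabilityMeasure ν]
  {κ : ∀ n k : ℕ, Kernel (Fin n → E) (Fin k → E)} {𝓔 : SymmDirichletForm ν}

lemma superPoincare_particleForm_iff (hϱ_pos : ∀ i, 0 < ϱ i) (hϱ_sum : HasSum ϱ 1) :
    SuperPoincare (confLaw ϱ (powerLaw ν)) (particleForm q ϱ κ 𝓔) ↔
      ∀ t : ℝ≥0, 0 < t → ∃ b : ℝ≥0, ∀ F, (particleForm q ϱ κ 𝓔).dom F →
        ∫⁻ γ, ‖F γ‖ₑ ^ 2 ∂confLaw ϱ (powerLaw ν) ≤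
          t * (diffusionEnergy ϱ (powerForm 𝓔) F + reactionEnergy q ϱ (powerLaw ν) κ F) +
            b * (∫⁻ γ, ‖F γ‖ₑ ∂confLaw ϱ (powerLaw ν)) ^ 2 :=
  haveI := isProbabilityMeasure_confLaw (μ := powerLaw ν) hϱ_pos hϱ_sum
  superPoincare_iff (fun _ hf => hf.1.1) fun _ => energy_particleForm_lt_top

theorem superPoincare_chainForm_of_particleForm (hϱ_pos : ∀ i, 0 < ϱ i) (hϱ_sum : HasSum ϱ 1)
    [∀ n k, IsMarkovKernel (κ n k)] (h𝓔 : 𝓔.Conservative)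
    (h : SuperPoincare (confLaw ϱ (powerLaw ν)) (particleForm q ϱ κ 𝓔)) :
    SuperPoincare (natLaw ϱ) (chainForm q ϱ) := by
  rw [superPoincare_particleForm_iff hϱ_pos hϱ_sum] at h
  rw [superPoincare_chainForm_iff hϱ_pos hϱ_sum]
  intro t ht
  obtain ⟨b, hb⟩ := h t ht
  refine ⟨b, fun r hr => ?_⟩
  have hrm : Measurable r := measurable_from_nat
  set F : FinConf E → ℝ := fun γ => r γ.card with hF
  have hFm : Measurable F := hrm.comp measurable_card
  have hFc : ∀ {n : ℕ} (x : Fin n → E), F (conf x) = r n := fun x => by simp [hF, card_conf]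
  have h2 : ∫⁻ γ, ‖F γ‖ₑ ^ 2 ∂confLaw ϱ (powerLaw ν) = ∫⁻ n, ‖r n‖ₑ ^ 2 ∂natLaw ϱ := by
    rw [lintegral_confLaw (hFm.enorm.pow_const 2).aemeasurable hϱ_pos, lintegral_natLaw]
    simp [hFc]
  have h1 : ∫⁻ γ, ‖F γ‖ₑ ∂confLaw ϱ (powerLaw ν) = ∫⁻ n, ‖r n‖ₑ ∂natLaw ϱ := by
    rw [lintegral_confLaw hFm.enorm.aemeasurable hϱ_pos, lintegral_natLaw]
    simp [hFc]
  have hd : diffusionEnergy ϱ (powerForm 𝓔) F = 0 := by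
    simp [diffusionEnergy, hFc, powerForm_energy_const h𝓔]
  have hre : reactionEnergy q ϱ (powerLaw ν) κ F = chainEnergy q ϱ r := by
    simp only [reactionEnergy, chainEnergy, addParticles_conf, hFc]
    refine tsum_congr fun n => tsum_congr fun k => ?_
    simp only [lintegral_const, measure_univ, mul_one]
    rw [← neg_sub, neg_sq]
  have hmem : MemLp F 2 (confLaw ϱ (powerLaw ν)) :=
    memLp_two_iff.2 ⟨hFm.aestronglyMeasurable, h2.trans_lt (memLp_two_iff.1 hr.1).2⟩
  have := hb F ⟨⟨hmem, fun n _ => by simpa only [hFc] using powerForm_dom_const h𝓔 n (r n),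
    hd.trans_lt ENNReal.zero_lt_top⟩, hmem, hre.trans_lt hr.2⟩
  rwa [h1, h2, hd, hre, zero_add] at this

/-- This is why `oneParticle` is defined through integrals against `γ`: they depend measurably on
the configuration. -/
lemma measurable_oneParticle {f : E → ℝ} (hf : Measurable f) : Measurable (oneParticle f) := by
  refine Measurable.ite (measurable_card (measurableSet_singleton 1)) (Measurable.sub ?_ ?_)
    measurable_const
  · exact ((Measure.measurable_lintegral hf.ennreal_ofReal).comp
      measurable_coe_measure).ennreal_toReal
  · exact ((Measure.measurable_lintegral hf.neg.ennreal_ofReal).comp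
      measurable_coe_measure).ennreal_toReal

theorem superPoincare_toEnergyForm_of_particleForm (hq : IsConservativeQMatrix q)
    (hϱ_pos : ∀ i, 0 < ϱ i) (hϱ_sum : HasSum ϱ 1)
    [∀ n k, IsMarkovKernel (κ n k)] (hκ : IsBirthKernel (powerLaw ν) κ) (h𝓔 : 𝓔.Conservative)
    (h : SuperPoincare (confLaw ϱ (powerLaw ν)) (particleForm q ϱ κ 𝓔)) :
    SuperPoincare ν 𝓔.toEnergyForm := by
  rw [superPoincare_particleForm_iff hϱ_pos hϱ_sum] at h
  rw [superPoincare_iff (fun _ hf => 𝓔.memLp_of_dom hf) fun _ hf => 𝓔.dom_iff_energy_lt_top.1 hf]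
  intro t ht
  -- Finite because row 1 of the `Q`-matrix is summable.
  have hC : ENNReal.ofReal (ϱ 0 * q 0 1) + ∑' k : ℕ, ENNReal.ofReal (ϱ 1 * q 1 (1 + (k + 1))) ≠ ∞ := by
    refine ENNReal.add_ne_top.2 ⟨ENNReal.ofReal_ne_top, ?_⟩
    have hs : Summable fun k : ℕ => ϱ 1 * q 1 (1 + (k + 1)) := by
      refine Summable.mul_left _ ((hq.2 1).summable.comp_injective (i := fun k => 1 + (k + 1)) ?_)
      intro a b hab
      simpa using hab
    rw [← ENNReal.ofReal_tsum_of_nonneg (fun k => mul_nonneg (hϱ_pos 1).le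
      (hq.1 _ _ (by omega))) hs]
    exact ENNReal.ofReal_ne_top
  obtain ⟨C, hC⟩ := WithTop.ne_top_iff_exists.1 hC
  set p : ℝ≥0 := (ϱ 1).toNNReal with hp_def
  have hp : 0 < p := Real.toNNReal_pos.2 (hϱ_pos 1)
  -- The two bounds on the parameter are the ones `absorb_le` asks for: twice it is at most `t`, and
  -- `C` times it at most `p / 2`.
  obtain ⟨b, hb⟩ := h (min (t / 2) (p / (2 * (C + 1)))) (by positivity)
  refine ⟨2 * b * p, fun f hf => ?_⟩
  -- `oneParticle` evaluates correctly at Dirac masses only for a measurable function.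
  obtain ⟨f', hf', hff'⟩ := (𝓔.memLp_of_dom hf).1.aemeasurable
  have hdom : 𝓔.toEnergyForm.dom f' := by
    rwa [𝓔.dom_iff_energy_lt_top, ← 𝓔.energy_congr hff', ← 𝓔.dom_iff_energy_lt_top]
  have hmem := 𝓔.memLp_of_dom hdom
  rw [𝓔.energy_congr hff', lintegral_congr_ae (hff'.mono fun x hx => show ‖f x‖ₑ = _ by rw [hx]),
    lintegral_congr_ae (hff'.mono fun x hx => show ‖f x‖ₑ ^ 2 = _ by rw [hx])]
  have hFm := measurable_oneParticle hf'
  have hint : ∀ g : ℝ → ℝ≥0∞, Measurable g → g 0 = 0 →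
      ∫⁻ γ, g (oneParticle f' γ) ∂confLaw ϱ (powerLaw ν) = p * ∫⁻ x, g (f' x) ∂ν := by
    intro g hg h0
    rw [lintegral_confLaw (g := fun γ => g (oneParticle f' γ)) (hg.comp hFm).aemeasurable hϱ_pos, tsum_eq_single 1]
    · simp only [oneParticle_conf_one hf']
      exact congrArg _ ((measurePreserving_eval (fun _ : Fin 1 => ν) 0).lintegral_comp
        (hg.comp hf'))
    · intro n hn
      simp [oneParticle_conf_of_ne f' hn, h0]
  have h1 := hint (fun a => ‖a‖ₑ) measurable_enorm (by simp)
  have h2 := hint (fun a => ‖a‖ₑ ^ 2) (measurable_enorm.pow_const 2) (by simp)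
  have hA := (memLp_two_iff.1 hmem).2
  have hF2 : MemLp (oneParticle f') 2 (confLaw ϱ (powerLaw ν)) :=
    memLp_two_iff.2 ⟨hFm.aestronglyMeasurable, by
      rw [h2]; exact ENNReal.mul_lt_top ENNReal.coe_lt_top hA⟩
  have hd : diffusionEnergy ϱ (powerForm 𝓔) (oneParticle f') =
      p * 𝓔.toEnergyForm.energy f' := by
    rw [diffusionEnergy, tsum_eq_single 0]
    · have : (fun x : Fin (0 + 1) → E => oneParticle f' (conf x)) = fun x => f' (x 0) :=
        funext fun x => oneParticle_conf_one hf' x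
      rw [this, powerForm_energy_one h𝓔]
      rfl
    · intro n hn
      have : n + 1 ≠ 1 := by omega
      simp [oneParticle_conf_of_ne f' this, powerForm_energy_const h𝓔]
  have hr := reactionEnergy_oneParticle_le (q := q) (ϱ := ϱ) hκ hf'
  rw [← hC] at hr
  have hmain := hb (oneParticle f') ⟨⟨hF2, fun n _ => ?_, ?_⟩, hF2, ?_⟩
  · rw [h1, h2, hd] at hmain
    refine absorb_le (C := C) hp ?_ ?_ ht hA.ne ?_ (hmain.trans (by gcongr; exact hr))
    · calc _ ≤ p / (2 * (C + 1)) * C := by gcongr; exact min_le_right _ _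
        _ = p / 2 * (C / (C + 1)) := by field_simp
        _ ≤ p / 2 := mul_le_of_le_one_right' (div_le_one_of_le₀ (by simp) (by simp))
    · calc _ ≤ 2 * (t / 2) := by gcongr; exact min_le_left _ _
        _ = t := by field_simp
    · exact (hmem.integrable (by norm_num)).2.ne
  · rcases eq_or_ne n 1 with rfl | hn
    · simpa only [oneParticle_conf_one hf'] using powerForm_dom_one h𝓔 hdom
    · simpa only [oneParticle_conf_of_ne f' hn] using powerForm_dom_const h𝓔 n 0
  · rw [hd]
    exact ENNReal.mul_lt_top ENNReal.coe_lt_top (𝓔.dom_iff_energy_lt_top.1 hdom)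
  · exact hr.trans_lt (ENNReal.mul_lt_top ENNReal.coe_lt_top hA)

end Necessity

/-! ### Truncating the chain inequality to finitely many states -/

section Chain

lemma sq_lintegral_le {X : Type*} [MeasurableSpace X] (μ : Measure X) {h : X → ℝ≥0∞}
    (hh : AEMeasurable h μ) : (∫⁻ x, h x ∂μ) ^ 2 ≤ μ Set.univ * ∫⁻ x, h x ^ 2 ∂μ := by
  have h1 := ENNReal.lintegral_mul_le_Lp_mul_Lq μ Real.HolderConjugate.two_two
    (aemeasurable_const (b := (1 : ℝ≥0∞))) hh
  simp only [Pi.mul_apply, one_mul, lintegral_const, ENNReal.rpow_ofNat, one_pow] at h1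
  have h2 : ∀ z : ℝ≥0∞, (z ^ (1 / 2 : ℝ)) ^ 2 = z := fun z => by
    rw [← ENNReal.rpow_natCast, ← ENNReal.rpow_mul]
    norm_num
  calc _ ≤ _ := pow_le_pow_left₀ zero_le h1 2
    _ = _ := by rw [mul_pow, h2, h2]

/-- From `(a + c)² ≤ 2a² + 2c²` and `2bη ≤ 1/2`, the tail `c` costs at most half of `x`. -/
lemma absorb_tail_le {t b η : ℝ≥0} (hη : b * η ≤ 1 / 4) {x e a c y : ℝ≥0∞} (hx : x ≠ ∞)
    (he : e ≠ ∞) (hy : y ≠ ∞) (hay : a ^ 2 ≤ y) (hcx : c ^ 2 ≤ η * x)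
    (h : x ≤ (t / 2 : ℝ≥0) * e + b * (a + c) ^ 2) : x ≤ t * e + (4 * b : ℝ≥0) * y := by
  have ha : a ≠ ∞ := by rintro rfl; simp [hy] at hay
  have hc : c ≠ ∞ := by
    rintro rfl
    simp [ENNReal.mul_eq_top, hx] at hcx
  lift x to ℝ≥0 using hx
  lift e to ℝ≥0 using he
  lift y to ℝ≥0 using hy
  lift a to ℝ≥0 using ha
  lift c to ℝ≥0 using hc
  norm_cast at *
  rw [← NNReal.coe_le_coe] at *
  push_cast at *
  have h1 := mul_le_mul_of_nonneg_left hay b.coe_nonneg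
  have h2 := mul_le_mul_of_nonneg_left hcx b.coe_nonneg
  have h3 := mul_le_mul_of_nonneg_right hη x.coe_nonneg
  have h4 := mul_nonneg b.coe_nonneg (sq_nonneg ((a : ℝ) - c))
  nlinarith

variable {q : ℕ → ℕ → ℝ} {ϱ : ℕ → ℝ}

/-- The super Poincaré inequality for the chain, with the `L¹` norm replaced by the `L²` norm on
finitely many states. -/
lemma exists_chain_truncation (hϱ_pos : ∀ i, 0 < ϱ i) (hϱ_sum : HasSum ϱ 1)
    (h : SuperPoincare (natLaw ϱ) (chainForm q ϱ)) (t : ℝ≥0) (ht : 0 < t) :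
    ∃ (N : ℕ) (B : ℝ≥0), ∀ r, (chainForm q ϱ).dom r →
      ∫⁻ n, ‖r n‖ₑ ^ 2 ∂natLaw ϱ ≤ t * chainEnergy q ϱ r +
        B * ∑ n ∈ Finset.range N, ENNReal.ofReal (ϱ n) * ‖r n‖ₑ ^ 2 := by
  have := isProbabilityMeasure_natLaw hϱ_pos hϱ_sum
  rw [superPoincare_chainForm_iff hϱ_pos hϱ_sum] at h
  obtain ⟨b, hb⟩ := h (t / 2) (by positivity)
  have htail : Tendsto (fun N : ℕ => natLaw ϱ (Set.Iio N)ᶜ) atTop (𝓝 0) := by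
    have h1 := tendsto_measure_iInter_atTop (μ := natLaw ϱ) (s := fun N : ℕ => (Set.Iio N)ᶜ)
      (fun N => MeasurableSet.nullMeasurableSet .of_discrete) (fun M N hMN => by
        exact Set.compl_subset_compl.2 (Set.Iio_subset_Iio hMN)) ⟨0, measure_ne_top _ _⟩
    have h2 : ⋂ N : ℕ, (Set.Iio N)ᶜ = ∅ := by
      ext n
      simp only [Set.mem_iInter, Set.mem_compl_iff, Set.mem_Iio, Set.mem_empty_iff_false, iff_false]
      exact fun h => h (n + 1) (Nat.lt_succ_self n)
    rw [h2, measure_empty] at h1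
    exact h1
  set η : ℝ≥0 := 1 / (4 * (b + 1)) with hη_def
  have hη : 0 < η := by positivity
  obtain ⟨N, hN⟩ := (htail.eventually_le_const (show (0 : ℝ≥0∞) < η by exact_mod_cast hη)).exists
  refine ⟨N, 4 * b, fun r hr => ?_⟩
  have hrm : Measurable fun n => ‖r n‖ₑ := measurable_from_nat
  have hx := (memLp_two_iff.1 hr.1).2
  have hfinset : ∫⁻ n in Set.Iio N, ‖r n‖ₑ ^ 2 ∂natLaw ϱ =
      ∑ n ∈ Finset.range N, ENNReal.ofReal (ϱ n) * ‖r n‖ₑ ^ 2 := by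
    rw [← lintegral_indicator .of_discrete, lintegral_natLaw, tsum_eq_sum (s := Finset.range N)]
    · refine Finset.sum_congr rfl fun n hn => ?_
      rw [Set.indicator_of_mem (by simpa using hn)]
    · intro n hn
      rw [Set.indicator_of_notMem (by simpa using hn), mul_zero]
  rw [← hfinset]
  have hsplit := lintegral_add_compl (μ := natLaw ϱ) (fun n => ‖r n‖ₑ)
    (A := Set.Iio N) .of_discrete
  have hm := hb r hr
  rw [← hsplit] at hm
  refine absorb_tail_le (η := η) ?_ hx.ne hr.2.ne
    ((setLIntegral_le_lintegral _ _).trans_lt hx).ne ?_ ?_ hm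
  · calc b * η = 1 / 4 * (b / (b + 1)) := by rw [hη_def]; field_simp
      _ ≤ 1 / 4 := mul_le_of_le_one_right' (div_le_one_of_le₀ (by simp) (by simp))
  · refine (sq_lintegral_le _ hrm.aemeasurable).trans ?_
    rw [Measure.restrict_apply_univ]
    exact mul_le_of_le_one_left' prob_le_one
  · refine (sq_lintegral_le _ hrm.aemeasurable).trans ?_
    rw [Measure.restrict_apply_univ]
    exact mul_le_mul' hN (setLIntegral_le_lintegral _ _)

end Chain

/-! ### Comparing the chain energy with the reaction energy -/

section Reaction

lemma lintegral_compProd_of_aemeasurable {X Y : Type*} [MeasurableSpace X] [MeasurableSpace Y]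
    {μ : Measure X} [SFinite μ] {κ : Kernel X Y} [IsSFiniteKernel κ] {g : X × Y → ℝ≥0∞}
    (hg : AEMeasurable g (μ ⊗ₘ κ)) :
    ∫⁻ p, g p ∂(μ ⊗ₘ κ) = ∫⁻ x, ∫⁻ y, g (x, y) ∂κ x ∂μ := by
  obtain ⟨g', hg', hae⟩ := hg
  rw [lintegral_congr_ae hae, Measure.lintegral_compProd hg']
  refine lintegral_congr_ae ?_
  filter_upwards [Measure.ae_ae_of_ae_compProd hae] with x hx
  exact lintegral_congr_ae (hx.mono fun y hy => hy.symm)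

lemma ofReal_sq_sub_eLpNorm_le {X : Type*} [MeasurableSpace X] {μ : Measure X} {u v : X → ℝ}
    (hu : MemLp u 2 μ) (hv : MemLp v 2 μ) :
    ENNReal.ofReal (((eLpNorm v 2 μ).toReal - (eLpNorm u 2 μ).toReal) ^ 2) ≤
      ∫⁻ x, ENNReal.ofReal ((u x - v x) ^ 2) ∂μ := by
  have h1 := abs_norm_sub_norm_le (hv.toLp v) (hu.toLp u)
  rw [← MemLp.toLp_sub, Lp.norm_toLp, Lp.norm_toLp, Lp.norm_toLp, eLpNorm_sub_comm] at h1
  have h2 := (hu.sub hv)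
  calc _ ≤ ENNReal.ofReal ((eLpNorm (u - v) 2 μ).toReal ^ 2) := by
        refine ENNReal.ofReal_le_ofReal ?_
        rw [← sq_abs]
        exact pow_le_pow_left₀ (abs_nonneg _) h1 2
    _ = (eLpNorm (u - v) 2 μ) ^ 2 := by
        rw [ENNReal.ofReal_pow ENNReal.toReal_nonneg, ENNReal.ofReal_toReal h2.2.ne]
    _ = ∫⁻ x, ‖(u - v) x‖ₑ ^ 2 ∂μ := by
        rw [eLpNorm_two_eq, ← ENNReal.rpow_natCast, ← ENNReal.rpow_mul]
        norm_num
    _ = _ := by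
        refine lintegral_congr fun x => ?_
        rw [ofReal_sq]; rfl

variable {E : Type*} [MeasurableSpace E] {ν : Measure E} [IsProbabilityMeasure ν]
  {q : ℕ → ℕ → ℝ} {ϱ : ℕ → ℝ} {κ : ∀ n k : ℕ, Kernel (Fin n → E) (Fin k → E)}

/-- The chain energy of the `L²` norms on the levels is bounded by the reaction energy. -/
lemma chainEnergy_le_reactionEnergy (hκ : IsBirthKernel (powerLaw ν) κ)
    [∀ n k, IsMarkovKernel (κ n k)] {F : FinConf E → ℝ}
    (hF : ∀ n, MemLp (fun x : Fin n → E => F (conf x)) 2 (powerLaw ν n)) :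
    chainEnergy q ϱ (fun n => (eLpNorm (fun x : Fin n → E => F (conf x)) 2 (powerLaw ν n)).toReal) ≤
      reactionEnergy q ϱ (powerLaw ν) κ F := by
  refine ENNReal.tsum_le_tsum fun n => ENNReal.tsum_le_tsum fun k => mul_le_mul_right ?_ _
  -- Appending the newborn particles and forgetting them both preserve measure from `νⁿ ⊗ κ`, so the
  -- two levels can be compared in the `L²` space of this one measure.
  have hA : MeasurePreserving (fun p : (Fin n → E) × (Fin (k + 1) → E) => Fin.append p.1 p.2)
      (powerLaw ν n ⊗ₘ κ n (k + 1)) (powerLaw ν (n + (k + 1))) :=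
    ⟨measurable_append n (k + 1), hκ.disintegration n (k + 1)⟩
  have hB : MeasurePreserving (Prod.fst : (Fin n → E) × (Fin (k + 1) → E) → (Fin n → E))
      (powerLaw ν n ⊗ₘ κ n (k + 1)) (powerLaw ν n) :=
    ⟨measurable_fst, Measure.fst_compProd _ _⟩
  have hu := (hF (n + (k + 1))).comp_measurePreserving hA
  have hv := (hF n).comp_measurePreserving hB
  beta_reduce
  rw [← eLpNorm_comp_measurePreserving (hF n).1 hB,
    ← eLpNorm_comp_measurePreserving (hF (n + (k + 1))).1 hA]
  refine (ofReal_sq_sub_eLpNorm_le hu hv).trans_eq ?_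
  refine (lintegral_compProd_of_aemeasurable
    (((hu.1.sub hv.1).aemeasurable.pow_const 2).ennreal_ofReal)).trans ?_
  simp only [addParticles_conf]
  rfl

end Reaction

/-! ### The inequality for `n` independent particles -/

section Diffusion

variable {E : Type*} [MeasurableSpace E] {ν : Measure E} [IsProbabilityMeasure ν]

lemma infLaw_map_restrict (n : ℕ) :
    (infLaw ν).map (fun x (i : Fin n) => x i) = powerLaw ν n := by
  have hm : Measurable fun (x : ℕ → E) (i : Fin n) => x i := by fun_prop
  refine (Measure.pi_eq fun s hs => ?_).symm
  rw [Measure.map_apply hm (MeasurableSet.univ_pi hs)]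
  set t : ℕ → Set E := fun i => if h : i < n then s ⟨i, h⟩ else Set.univ with ht
  have : (fun (x : ℕ → E) (i : Fin n) => x i) ⁻¹' Set.univ.pi s =
      Set.pi (Finset.range n : Set ℕ) t := by
    ext x
    simp only [Set.mem_preimage, Set.mem_pi, Set.mem_univ, true_implies, Finset.mem_coe,
      Finset.mem_range]
    constructor
    · intro h i hi
      simpa [ht, hi] using h ⟨i, hi⟩
    · intro h i
      simpa [ht] using h i i.2
  rw [this, infLaw, Measure.infinitePi_pi, ← Fin.prod_univ_eq_prod_range (fun i => ν (t i))]
  · simp [ht]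
  · intro i hi
    rw [ht]
    dsimp only
    split_ifs
    · exact hs _
    · exact .univ

lemma coordSlice_restrict {E : Type*} {n : ℕ} (f : (Fin n → E) → ℝ) (x : ℕ → E) (i : Fin n) :
    coordSlice (fun x => f fun j => x j) x i = fun y => f (Function.update (fun j => x j) i y) := by
  funext y
  refine congrArg f (funext fun j => ?_)
  by_cases h : j = i
  · subst h; simp
  · rw [Function.update_of_ne h, Function.update_of_ne (fun h' => h (Fin.ext h'))]

/-- One inequality suffices, and `lintegral_map_le` gives it without measurability of the slice
energies. -/
lemma sum_lintegral_energy_le (𝓔 : SymmDirichletForm ν) (n : ℕ) (f : (Fin n → E) → ℝ) :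
    ∑ i : Fin n, ∫⁻ x, 𝓔.toEnergyForm.energy (fun y => f (Function.update x i y)) ∂powerLaw ν n ≤
      (powerForm 𝓔 n).energy f := by
  change _ ≤ infEnergy 𝓔 (fun x => f fun j => x j)
  refine le_trans ?_ (ENNReal.sum_le_tsum (Finset.range n))
  rw [← Fin.sum_univ_eq_sum_range (fun i => ∫⁻ x, 𝓔.toEnergyForm.energy
    (coordSlice (fun x => f fun j => x j) x i) ∂infLaw ν)]
  refine Finset.sum_le_sum fun i _ => ?_
  simp only [coordSlice_restrict]
  rw [← infLaw_map_restrict]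
  exact lintegral_map_le _ _

lemma sum_le_diffusionEnergy (ϱ : ℕ → ℝ) (𝓔 : SymmDirichletForm ν) (F : FinConf E → ℝ) (N : ℕ) :
    ∑ n ∈ Finset.range N, ENNReal.ofReal (ϱ n) * ∑ i : Fin n, ∫⁻ x, 𝓔.toEnergyForm.energy
      (fun y => F (conf (Function.update x i y))) ∂powerLaw ν n ≤
        diffusionEnergy ϱ (powerForm 𝓔) F := by
  refine (ENNReal.sum_le_tsum _).trans ?_
  -- Level 0 has no coordinates and drops out, which matches the diffusion energy starting at level
  -- 1.
  rw [tsum_eq_zero_add' ENNReal.summable, Finset.univ_eq_empty, Finset.sum_empty, mul_zero, zero_add]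
  exact ENNReal.tsum_le_tsum fun n => mul_le_mul_right
    (sum_lintegral_energy_le 𝓔 (n + 1) fun x => F (conf x)) _

/-- By Tonelli a null set has null slices, so `F` may be replaced by a measurable representative
inside slice energies. -/
lemma ae_ae_update {ι : Type*} [Fintype ι] [DecidableEq ι] {p : (ι → E) → Prop}
    (h : ∀ᵐ x ∂Measure.pi (fun _ : ι => ν), p x) (i : ι) :
    ∀ᵐ x ∂Measure.pi (fun _ : ι => ν), ∀ᵐ y ∂ν, p (Function.update x i y) := by
  obtain ⟨s, hps, hs, h0⟩ := exists_measurable_superset_of_null (ae_iff.1 h)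
  have hm : Measurable (s.indicator (fun _ => (1 : ℝ≥0∞))) := measurable_one.indicator hs
  have h1 := lintegral_lmarginal (μ := fun _ : ι => ν) {i} hm
  rw [lintegral_indicator hs, setLIntegral_one, h0, lintegral_eq_zero_iff (hm.lmarginal _),
    lmarginal_singleton] at h1
  filter_upwards [h1] with x hx
  have hx' : ∫⁻ y, s.indicator (fun _ => (1 : ℝ≥0∞)) (Function.update x i y) ∂ν = 0 := hx
  rw [lintegral_eq_zero_iff (f := fun y => s.indicator (fun _ => (1 : ℝ≥0∞))
    (Function.update x i y)) (hm.comp (measurable_update x))] at hx'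
  filter_upwards [hx'] with y hy
  by_contra hpy
  have := Set.indicator_of_mem (hps hpy) (fun _ => (1 : ℝ≥0∞))
  simp only [Pi.zero_apply] at hy
  rw [this] at hy
  exact one_ne_zero hy

/-- The super Poincaré inequality for `n` independent particles. -/
lemma exists_lintegral_sq_le_powerForm {𝓔 : SymmDirichletForm ν} [MeasureTheory.IsSeparable ν]
    (h : SuperPoincare ν 𝓔.toEnergyForm) (n : ℕ) (t : ℝ≥0) (ht : 0 < t) :
    ∃ B : ℝ≥0, ∀ f : (Fin n → E) → ℝ, MemLp f 2 (powerLaw ν n) →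
      ∫⁻ x, ‖f x‖ₑ ^ 2 ∂powerLaw ν n ≤
        t * (∑ i : Fin n, ∫⁻ x, 𝓔.toEnergyForm.energy (fun y => f (Function.update x i y))
          ∂powerLaw ν n) + B * (∫⁻ x, ‖f x‖ₑ ∂powerLaw ν n) ^ 2 := by
  rw [superPoincare_toEnergyForm_iff] at h
  obtain ⟨B, hB⟩ := 𝓔.exists_lintegral_sq_le_pi h (Finset.univ : Finset (Fin n)) t ht
  refine ⟨B, fun f hf => ?_⟩
  obtain ⟨f', hf', hae⟩ := hf.1.aemeasurable
  have hfin := (memLp_two_iff.1 ((memLp_congr_ae hae).1 hf)).2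
  have h1 := hB f' hf' hfin
  simp only [lmarginal_univ, lintegral_const, measure_univ, mul_one] at h1
  rw [lintegral_congr_ae (hae.mono fun x hx => show ‖f x‖ₑ ^ 2 = ‖f' x‖ₑ ^ 2 by rw [hx]),
    lintegral_congr_ae (hae.mono fun x hx => show ‖f x‖ₑ = ‖f' x‖ₑ by rw [hx])]
  refine h1.trans_eq ?_
  congr 2
  refine Finset.sum_congr rfl fun i _ => lintegral_congr_ae ?_
  filter_upwards [ae_ae_update hae i] with x hx
  exact (𝓔.energy_congr hx).symm

end Diffusion

/-! ### Sufficiency -/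

section Sufficiency

variable {E : Type*} [TopologicalSpace E] [PolishSpace E] [MeasurableSpace E] [BorelSpace E]
  {q : ℕ → ℕ → ℝ} {ϱ : ℕ → ℝ} {ν : Measure E} [IsProbabilityMeasure ν]
  {κ : ∀ n k : ℕ, Kernel (Fin n → E) (Fin k → E)} {𝓔 : SymmDirichletForm ν}

theorem superPoincare_particleForm (hϱ_pos : ∀ i, 0 < ϱ i) (hϱ_sum : HasSum ϱ 1)
    [∀ n k, IsMarkovKernel (κ n k)] (hκ : IsBirthKernel (powerLaw ν) κ)
    (hν : SuperPoincare ν 𝓔.toEnergyForm) (hQ : SuperPoincare (natLaw ϱ) (chainForm q ϱ)) :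
    SuperPoincare (confLaw ϱ (powerLaw ν)) (particleForm q ϱ κ 𝓔) := by
  rw [superPoincare_particleForm_iff hϱ_pos hϱ_sum]
  intro t ht
  obtain ⟨N, B, hB⟩ := exists_chain_truncation hϱ_pos hϱ_sum hQ t ht
  -- The parameter `t / (B + 1)` survives multiplication by the constant `B` of the truncated chain
  -- inequality.
  choose b hb using fun n => exists_lintegral_sq_le_powerForm hν n (t / (B + 1)) (by positivity)
  refine ⟨B * ∑ n ∈ Finset.range N, b n / (ϱ n).toNNReal, fun F hF => ?_⟩
  have hF2 : MemLp F 2 (confLaw ϱ (powerLaw ν)) := hF.1.1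
  have hsq := lintegral_confLaw (hF2.1.enorm.pow_const 2) hϱ_pos
  have hone := lintegral_confLaw hF2.1.enorm hϱ_pos
  have hϱ0 : ∀ n, ENNReal.ofReal (ϱ n) ≠ 0 := fun n => by simpa using hϱ_pos n
  have hmem : ∀ n, MemLp (fun x : Fin n → E => F (conf x)) 2 (powerLaw ν n) := fun n => by
    refine memLp_two_iff.2 ⟨?_, ?_⟩
    · obtain ⟨F', hF', hae⟩ := hF2.1.aemeasurable
      exact ⟨fun x => F' (conf x), (hF'.comp measurable_conf).stronglyMeasurable,
        ae_conf hae (hϱ_pos n)⟩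
    · have h1 := (memLp_two_iff.1 hF2).2
      rw [hsq] at h1
      have h2 := (ENNReal.le_tsum n).trans_lt h1
      exact ENNReal.lt_top_of_mul_ne_top_right h2.ne (hϱ0 n)
  set a : ℕ → ℝ≥0∞ := fun n => ∫⁻ x, ‖F (conf x)‖ₑ ^ 2 ∂powerLaw ν n with ha
  set c : ℕ → ℝ≥0∞ := fun n => ∫⁻ x, ‖F (conf x)‖ₑ ∂powerLaw ν n with hc
  set T : ℕ → ℝ≥0∞ := fun n => ∑ i : Fin n, ∫⁻ x, 𝓔.toEnergyForm.energy
    (fun y => F (conf (Function.update x i y))) ∂powerLaw ν n with hT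
  set r : ℕ → ℝ := fun n =>
    (eLpNorm (fun x : Fin n → E => F (conf x)) 2 (powerLaw ν n)).toReal with hr
  have hra : ∀ n, ‖r n‖ₑ ^ 2 = a n := fun n => by
    rw [hr, Real.enorm_of_nonneg ENNReal.toReal_nonneg, ENNReal.ofReal_toReal (hmem n).2.ne,
      eLpNorm_two_eq, ← ENNReal.rpow_natCast, ← ENNReal.rpow_mul]
    norm_num [ha]
  have hx : ∫⁻ n, ‖r n‖ₑ ^ 2 ∂natLaw ϱ = ∫⁻ γ, ‖F γ‖ₑ ^ 2 ∂confLaw ϱ (powerLaw ν) := by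
    rw [hsq, lintegral_natLaw]
    simp only [hra]; rfl
  have hre : chainEnergy q ϱ r ≤ reactionEnergy q ϱ (powerLaw ν) κ F :=
    chainEnergy_le_reactionEnergy hκ hmem
  have hmain := hB r ⟨memLp_two_iff.2 ⟨measurable_from_nat.aestronglyMeasurable,
    hx.trans_lt (memLp_two_iff.1 hF2).2⟩, hre.trans_lt hF.2.2⟩
  rw [hx] at hmain
  simp only [hra] at hmain
  have hdiff : ∑ n ∈ Finset.range N, ENNReal.ofReal (ϱ n) * T n ≤
      diffusionEnergy ϱ (powerForm 𝓔) F := sum_le_diffusionEnergy ϱ 𝓔 F N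
  -- One factor `ϱ n` is available but two are needed to turn `c n ^ 2` into `(ϱ n * c n) ^ 2`;
  -- hence the division by `ϱ n`, harmless for finitely many levels.
  have hmean : ∀ n, ENNReal.ofReal (ϱ n) * (b n * c n ^ 2) ≤
      (b n / (ϱ n).toNNReal : ℝ≥0) * (∫⁻ γ, ‖F γ‖ₑ ∂confLaw ϱ (powerLaw ν)) ^ 2 := fun n => by
    have h1 : ENNReal.ofReal (ϱ n) * c n ≤ ∫⁻ γ, ‖F γ‖ₑ ∂confLaw ϱ (powerLaw ν) := by
      rw [hone]
      exact ENNReal.le_tsum n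
    have h2 : (b n : ℝ≥0∞) = (b n / (ϱ n).toNNReal : ℝ≥0) * ENNReal.ofReal (ϱ n) := by
      rw [ENNReal.ofReal, ← ENNReal.coe_mul, div_mul_cancel₀]
      exact (Real.toNNReal_pos.2 (hϱ_pos n)).ne'
    calc _ = (b n / (ϱ n).toNNReal : ℝ≥0) * (ENNReal.ofReal (ϱ n) * c n) ^ 2 := by
          rw [h2]; ring
      _ ≤ _ := by gcongr
  have hBt : (B : ℝ≥0∞) * (t / (B + 1) : ℝ≥0) ≤ t := by
    norm_cast
    calc B * (t / (B + 1)) = t * (B / (B + 1)) := by field_simp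
      _ ≤ t := mul_le_of_le_one_right' (div_le_one_of_le₀ (by simp) (by simp))
  have hsum : ∑ n ∈ Finset.range N, ENNReal.ofReal (ϱ n) * a n ≤
      (t / (B + 1) : ℝ≥0) * diffusionEnergy ϱ (powerForm 𝓔) F +
        (∑ n ∈ Finset.range N, b n / (ϱ n).toNNReal : ℝ≥0) *
          (∫⁻ γ, ‖F γ‖ₑ ∂confLaw ϱ (powerLaw ν)) ^ 2 := by
    calc _ ≤ ∑ n ∈ Finset.range N, ((t / (B + 1) : ℝ≥0) * (ENNReal.ofReal (ϱ n) * T n) +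
          (b n / (ϱ n).toNNReal : ℝ≥0) * (∫⁻ γ, ‖F γ‖ₑ ∂confLaw ϱ (powerLaw ν)) ^ 2) := by
          refine Finset.sum_le_sum fun n _ => ?_
          calc _ ≤ ENNReal.ofReal (ϱ n) * ((t / (B + 1) : ℝ≥0) * T n + b n * c n ^ 2) :=
                mul_le_mul_right (hb n (fun x => F (conf x)) (hmem n)) _
            _ = (t / (B + 1) : ℝ≥0) * (ENNReal.ofReal (ϱ n) * T n) +
                ENNReal.ofReal (ϱ n) * (b n * c n ^ 2) := by ring
            _ ≤ _ := add_le_add le_rfl (hmean n)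
      _ ≤ _ := by
          rw [Finset.sum_add_distrib, ← Finset.mul_sum, ← Finset.sum_mul, ENNReal.ofNNReal_finsetSum]
          gcongr
  calc _ ≤ _ := hmain
    _ ≤ t * reactionEnergy q ϱ (powerLaw ν) κ F +
        B * ((t / (B + 1) : ℝ≥0) * diffusionEnergy ϱ (powerForm 𝓔) F +
          (∑ n ∈ Finset.range N, b n / (ϱ n).toNNReal : ℝ≥0) *
          (∫⁻ γ, ‖F γ‖ₑ ∂confLaw ϱ (powerLaw ν)) ^ 2) := by gcongr
    _ = t * reactionEnergy q ϱ (powerLaw ν) κ F +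
        (B * (t / (B + 1) : ℝ≥0)) * diffusionEnergy ϱ (powerForm 𝓔) F +
          (B * ∑ n ∈ Finset.range N, b n / (ϱ n).toNNReal : ℝ≥0) *
          (∫⁻ γ, ‖F γ‖ₑ ∂confLaw ϱ (powerLaw ν)) ^ 2 := by
        rw [ENNReal.coe_mul B (∑ n ∈ Finset.range N, b n / (ϱ n).toNNReal)]; ring
    _ ≤ t * reactionEnergy q ϱ (powerLaw ν) κ F +
        t * diffusionEnergy ϱ (powerForm 𝓔) F + _ := by gcongr
    _ = _ := by ring

end Sufficiency

end

theorem corollary4p5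
    {E : Type*} [TopologicalSpace E] [PolishSpace E] [MeasurableSpace E] [BorelSpace E]
    -- the chain for the number of particles, reversible with respect to `ϱ`
    (q : ℕ → ℕ → ℝ) (hq : IsConservativeQMatrix q)
    (ϱ : ℕ → ℝ) (hϱ_pos : ∀ i, 0 < ϱ i) (hϱ_sum : HasSum ϱ 1)
    (hrev : ∀ i j, ϱ i * q i j = ϱ j * q j i)
    -- the reference measures `νⁿ` and the laws of the newborn particles
    (ν : Measure E) [IsProbabilityMeasure ν]
    (κ : ∀ n k : ℕ, Kernel (Fin n → E) (Fin k → E)) [∀ n k, IsMarkovKernel (κ n k)]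
    (hκ : IsBirthKernel (powerLaw ν) κ)
    -- the one-particle form
    (𝓔 : SymmDirichletForm ν) (h𝓔 : 𝓔.Conservative)
    (hgap : 0 < spectralGap (infLaw ν) (infForm 𝓔)) :
    SuperPoincare (confLaw ϱ (powerLaw ν))
        ((diffusionForm ϱ (powerLaw ν) (powerForm 𝓔)).sum
          (reactionForm q ϱ (powerLaw ν) κ)) ↔
      SuperPoincare ν 𝓔.toEnergyForm ∧
        SuperPoincare (natLaw ϱ) (chainForm q ϱ) := by
  refine ⟨fun h => ⟨?_, ?_⟩, fun h => ?_⟩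
  · exact superPoincare_toEnergyForm_of_particleForm hq hϱ_pos hϱ_sum hκ h𝓔 h
  · exact superPoincare_chainForm_of_particleForm hϱ_pos hϱ_sum h𝓔 h
  · exact superPoincare_particleForm hϱ_pos hϱ_sum hκ h.1 h.2
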